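/- Let $p,q$ be complex-valued functions of bounded variation on $[0,\pi]$, $Q(x)=\begin{pmatrix}p(x)&q(x)\\ q(x)&-p(x)\end{pmatrix}$, and for $t\in\mathbb C$ let $L_t(Q)$ be the operator generated in $L_2([0,\pi];\mathbb C^2)$ by $$\begin{pmatrix}0&1\\-1&0\end{pmatrix}\mathbf y'(x)+Q(x)\mathbf y(x),\qquad \mathbf y(\pi)=e^{i\pi t}\mathbf y(0).$$ Let $\mathbf c(x,\lambda)=(c_1,c_2)^T$ and $\mathbf s(x,\lambda)=(s_1,s_2)^T$ be the solutions of $\begin{pmatrix}0&1\\-1&0\end{pmatrix}\mathbf y'+Q\mathbf y=\lambda\mathbf y$ with $\mathbf c(0,\lambda)=(1,0)^T$, $\mathbf s(0,\lambda)=(0,1)^T$, and put $F(\lambda)=c_1(\pi,\lambda)+s_2(\pi,\lambda)$. Fix $h\in(0,1/10)$ and let $$D_h(0,1)=\{t\in\mathbb C:|\operatorname{Im}t|\le 2h,\ -h\le\operatorname{Re}t\le 2-h\}\setminus\big(\{|t|<h\}\cup\{|t-1|<h\}\big).$$ Let $\lambda_{n,1}(t)$ and $\lambda_{n,2}(t)$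 ($n\in\mathbb Z$, $|n|$ large, $t\in D_h(0,1)$) be eigenvalues of $L_t(Q)$ with $$\lambda_{n,1}(t)=2n+t+O(1/n),\qquad \lambda_{n,2}(t)=2n-t+O(1/n)\qquad(|n|\to\infty)$$ uniformly in $t\in D_h(0,1)$; such eigenvalues exist. For $j=1,2$ put $$\Phi_{n,j,t}(x)=s_1(\pi,\lambda)\,\mathbf c(x,\lambda)+\big(e^{i\pi t}-c_1(\pi,\lambda)\big)\,\mathbf s(x,\lambda),\qquad \lambda=\lambda_{n,j}(t).$$ Then, for all sufficiently large $|n|$ and all $t\in D_h(0,1)$, $F'(\lambda_{n,j}(t))\ne0$, $s_1(\pi,\lambda_{n,j}(t))\neq 0$ and $\Phi_{n,j,t}$ is an eigenfunction of $L_t(Q)$ for the eigenvalue $\lambda_{n,j}(t)$; and, normalized by the factor $1/s_1(\pi,\lambda_{n,j}(t))$, these eigenfunctions satisfy $$\frac{\Phi_{n,1,t}(x)}{s_1(\pi,\lambda_{n,1}(t))}=\begin{pmatrix}1\\-i\end{pmatrix}e^{i(2n+t)x}+O\Big(\frac1n\Big),\qquad \frac{\Phi_{n,2,t}(x)}{s_1(\pi,\lambda_{n,2}(t))}=\begin{pmatrix}1\\i\end{pmatrix}e^{i(-2n+t)x}+O\Big(\frac1n\Big)$$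 as $|n|\to\infty$, uniformly in $t\in D_h(0,1)$ and $x\in[0,\pi]$. -/

import Mathlib

open MeasureTheory Set
open scoped Real Matrix

noncomputable section

namespace Dirac

/-- The constant matrix in front of the derivative in the Dirac expression. -/
def J : Matrix (Fin 2) (Fin 2) ℂ := !![0, 1; -1, 0]

/-- The potential matrix `Q(x)`. -/
def Q (p q : ℝ → ℂ) (x : ℝ) : Matrix (Fin 2) (Fin 2) ℂ := !![p x, q x; q x, -p x]

/-- `y` is a solution of `J y' + Q y = lam y` on `[0, π]`: it is absolutely continuous there and
satisfies the equation almost everywhere. -/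
def IsSolution (p q : ℝ → ℂ) (lam : ℂ) (y : ℝ → Fin 2 → ℂ) : Prop :=
  AbsolutelyContinuousOnInterval y 0 π ∧
    ∀ᵐ x ∂(volume.restrict (Icc 0 π)),
      DifferentiableAt ℝ y x ∧ J *ᵥ deriv y x + Q p q x *ᵥ y x = lam • y x

/-- The solution of `J y' + Q y = lam y` on `[0, π]` with initial value `y 0 = v`. Its values on
`[0, π]` are uniquely determined; the values elsewhere are irrelevant. -/
def solution (p q : ℝ → ℂ) (lam : ℂ) (v : Fin 2 → ℂ) : ℝ → Fin 2 → ℂ :=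
  Classical.epsilon fun y => IsSolution p q lam y ∧ y 0 = v

/-- The fundamental solution `c(x, lam)` with `c(0, lam) = (1, 0)`. -/
def c (p q : ℝ → ℂ) (lam : ℂ) : ℝ → Fin 2 → ℂ := solution p q lam ![1, 0]

/-- The fundamental solution `s(x, lam)` with `s(0, lam) = (0, 1)`. -/
def s (p q : ℝ → ℂ) (lam : ℂ) : ℝ → Fin 2 → ℂ := solution p q lam ![0, 1]

/-- `F(lam) = c₁(π, lam) + s₂(π, lam)`. -/
def F (p q : ℝ → ℂ) (lam : ℂ) : ℂ := c p q lam π 0 + s p q lam π 1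

/-- `y` is an eigenfunction, with eigenvalue `lam`, of the operator `L_t(Q)` generated in
`L²([0, π]; ℂ²)` by `J y' + Q y` and the boundary condition `y(π) = exp (i π t) y(0)`.
(As `Q` is bounded, `J y' + Q y = lam y` makes `y'` square integrable.) -/
def IsEigenfunction (p q : ℝ → ℂ) (t lam : ℂ) (y : ℝ → Fin 2 → ℂ) : Prop :=
  IsSolution p q lam y ∧ y π = Complex.exp (Complex.I * π * t) • y 0 ∧ ∃ x ∈ Icc 0 π, y x ≠ 0

/-- `lam` is an eigenvalue of `L_t(Q)`. -/
def IsEigenvalue (p q : ℝ → ℂ) (t lam : ℂ) : Prop := ∃ y, IsEigenfunction p q t lam y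

/-- `Φ_t(x) = s₁(π, lam) c(x, lam) + (exp (i π t) - c₁(π, lam)) s(x, lam)`. -/
def Phi (p q : ℝ → ℂ) (t lam : ℂ) (x : ℝ) : Fin 2 → ℂ :=
  s p q lam π 0 • c p q lam x
    + (Complex.exp (Complex.I * π * t) - c p q lam π 0) • s p q lam x

/-- The set `D_h(0,1)`: the rectangle `|Im t| ≤ 2h`, `-h ≤ Re t ≤ 2 - h` without the open discs of
radius `h` around `0` and `1`. -/
def D (h : ℝ) : Set ℂ :=
  {t : ℂ | |t.im| ≤ 2 * h ∧ -h ≤ t.re ∧ t.re ≤ 2 - h} \ (Metric.ball 0 h ∪ Metric.ball 1 h)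

/-- `lam n t`, for `|n|` large and `t ∈ D_h(0,1)`, is an eigenvalue of `L_t(Q)`, and
`lam n t = 2n + σt + O(1/n)` uniformly in `t`. The sequences `λ_{n,1}` and `λ_{n,2}` are
those with `σ = 1` and `σ = -1`. -/
def IsEigenvalueSequence (p q : ℝ → ℂ) (h : ℝ) (σ : ℂ) (lam : ℤ → ℂ → ℂ) : Prop :=
  ∃ N : ℕ, ∃ C : ℝ, ∀ n : ℤ, (N : ℤ) < |n| → ∀ t ∈ D h,
    IsEigenvalue p q t (lam n t) ∧ ‖lam n t - (2 * n + σ * t)‖ ≤ C / |(n : ℝ)|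

end Dirac

end

/-! For a solution `y` put `U = exp(-iλx)(y₁ + i y₂)` and `V = exp(iλx)(y₁ - i y₂)`. For the free
equation both are constant; in general `U' = αV`, `V' = βU` with `α = (q - ip)exp(-2iλx)`, `β = (q +
ip)exp(2iλx)`. Bounded variation makes the primitives of `α` and `β` of size `O(1/λ)` in a
horizontal strip. Subtracting `V` times the primitive of `α` from `U` leaves a function with
derivative `O(1/λ)`, and symmetrically for `V`, so solutions with bounded initial data differ from
free ones by `O(1/λ)` (`exists_solution_asymptotics`).

Hence `c₁(π) = cos πλ`, `s₁(π) = -sin πλ` and `F = 2 cos πλ`, each up to `O(1/λ)`. The Wronskian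
identity turns the eigenvalue condition into `F(λ) = 2 cos πt`. On the compact set `D h` the
function `|sin πt|` has a positive minimum, because the only integers in the rectangle are 0 and 1
and their discs are removed. This bounds `s₁(π, λ)` away from 0 and, with Cauchy's estimate for `F -
2 cos πλ`, gives `F' ≠ 0`. A quantitative open mapping argument on a circle of radius `C/|n|`
produces the eigenvalues.

The two families are treated together through `σ = ±1`, `λ = 2n + σt + O(1/n)`. The normalized
eigenfunction is `c + m s` with `m = (exp(iπt) - c₁(π)) / s₁(π) = -iσ + O(1/n)`. The free solution
with initial value `(1, -iσ)` is `exp(iσλx)(1, -iσ)`, and `σλ = 2nσ + t + O(1/n)`. -/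

noncomputable section

/-! ### Absolutely continuous functions with bounded derivative -/

section FundamentalTheorem

variable {E : Type*} [NormedAddCommGroup E] [NormedSpace ℝ E] {a b K : ℝ}

/-- The primitive of a function that is bounded almost everywhere is Lipschitz. -/
theorem lipschitzOnWith_integral_of_ae_norm_le {g : ℝ → E} (hab : a ≤ b) (hK : 0 ≤ K)
    (hg : IntervalIntegrable g volume a b) (hb : ∀ᵐ x, x ∈ Icc a b → ‖g x‖ ≤ K) :
    LipschitzOnWith K.toNNReal (fun x => ∫ s in a..x, g s) (uIcc a b) := by
  refine LipschitzOnWith.of_dist_le_mul fun x hx y hy => ?_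
  rw [uIcc_of_le hab] at hx hy
  have hi : ∀ z ∈ Icc a b, IntervalIntegrable g volume a z := fun z hz =>
    hg.mono_set (by rw [uIcc_of_le hab, uIcc_of_le hz.1]; exact Icc_subset_Icc_right hz.2)
  rw [dist_eq_norm, intervalIntegral.integral_interval_sub_left (hi x hx) (hi y hy),
    Real.coe_toNNReal _ hK, Real.dist_eq]
  refine intervalIntegral.norm_integral_le_of_norm_le_const_ae ?_
  filter_upwards [hb] with s hs hsm
  refine hs ?_
  have := uIoc_subset_uIcc hsm
  exact (uIcc_subset_Icc hy hx) this

variable [CompleteSpace E]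

/-- The bound makes the primitive of `deriv f` Lipschitz, hence absolutely continuous; its
difference with `f` has zero derivative almost everywhere and is therefore constant. -/
theorem AbsolutelyContinuousOnInterval.sub_eq_integral_deriv {f : ℝ → E} (hab : a ≤ b)
    (hf : AbsolutelyContinuousOnInterval f a b)
    (hd : ∀ᵐ x, x ∈ Icc a b → DifferentiableAt ℝ f x ∧ ‖deriv f x‖ ≤ K) :
    IntervalIntegrable (deriv f) volume a b ∧
      ∀ x ∈ Icc a b, f x - f a = ∫ s in a..x, deriv f s := by
  wlog hK : 0 ≤ K generalizing K
  · refine this (K := |K|) ?_ (abs_nonneg K)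
    filter_upwards [hd] with x hx hm using ⟨(hx hm).1, (hx hm).2.trans (le_abs_self K)⟩
  have hint : IntervalIntegrable (deriv f) volume a b := by
    rw [intervalIntegrable_iff_integrableOn_Icc_of_le hab]
    refine Measure.integrableOn_of_bounded (M := K) (by simp)
      (aestronglyMeasurable_deriv f _) ?_
    rw [ae_restrict_iff' measurableSet_Icc]
    filter_upwards [hd] with x hx hm using (hx hm).2
  refine ⟨hint, ?_⟩
  have hac := (lipschitzOnWith_integral_of_ae_norm_le hab hK hint
    (by filter_upwards [hd] with x hx hm using (hx hm).2)).absolutelyContinuousOnInterval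
  obtain ⟨C, hC⟩ := (hf.sub hac).const_of_ae_hasDerivAt_zero (by
    filter_upwards [hd, hint.ae_hasDerivAt_integral] with x hx hx' hm
    have h1 := (hx (by rwa [uIcc_of_le hab] at hm)).1.hasDerivAt
    simpa using h1.sub (hx' hm a left_mem_uIcc))
  rw [uIcc_of_le hab] at hC
  intro x hx
  have h1 := hC x hx
  have h2 := hC a (left_mem_Icc.2 hab)
  simp only [Pi.sub_apply, intervalIntegral.integral_same, sub_zero] at h1 h2
  rw [h2, ← h1]; abel

theorem AbsolutelyContinuousOnInterval.norm_sub_le_of_ae_norm_deriv_le {f : ℝ → E} (hab : a ≤ b)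
    (hf : AbsolutelyContinuousOnInterval f a b)
    (hd : ∀ᵐ x, x ∈ Icc a b → DifferentiableAt ℝ f x ∧ ‖deriv f x‖ ≤ K) {x : ℝ}
    (hx : x ∈ Icc a b) : ‖f x - f a‖ ≤ K * (x - a) := by
  rw [(hf.sub_eq_integral_deriv hab hd).2 x hx]
  refine (intervalIntegral.norm_integral_le_of_norm_le_const_ae (C := K) ?_).trans
    (by rw [abs_of_nonneg (by linarith [hx.1])])
  filter_upwards [hd] with s hs hm
  rw [uIoc_of_le hx.1] at hm
  exact (hs ⟨hm.1.le, hm.2.trans hx.2⟩).2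

end FundamentalTheorem

/-! ### Functions of bounded variation and their oscillatory integrals -/

section BoundedVariation

variable {f : ℝ → ℂ} {a b : ℝ}

theorem BoundedVariationOn.exists_norm_le {α E : Type*} [LinearOrder α] [SeminormedAddCommGroup E]
    {f : α → E} {s : Set α} (hf : BoundedVariationOn f s) : ∃ M, 0 ≤ M ∧ ∀ x ∈ s, ‖f x‖ ≤ M := by
  rcases s.eq_empty_or_nonempty with rfl | ⟨y, hy⟩
  · exact ⟨0, le_rfl, by simp⟩
  refine ⟨(eVariationOn f s).toReal + ‖f y‖, by positivity, fun x hx => ?_⟩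
  have := hf.dist_le hx hy
  rw [dist_eq_norm] at this
  linarith [norm_sub_norm_le (f x) (f y)]

/-- The real and imaginary parts are differences of monotone functions, which are measurable. -/
theorem BoundedVariationOn.aestronglyMeasurable_Icc (hf : BoundedVariationOn f (Icc a b)) :
    AEStronglyMeasurable f (volume.restrict (Icc a b)) := by
  have real : ∀ g : ℝ → ℝ, BoundedVariationOn g (Icc a b) →
      AEMeasurable g (volume.restrict (Icc a b)) := by
    intro g hg
    obtain ⟨p, q, hp, hq, rfl⟩ :=
      hg.locallyBoundedVariationOn.exists_monotoneOn_sub_monotoneOn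
    exact (aemeasurable_restrict_of_monotoneOn measurableSet_Icc hp).sub
      (aemeasurable_restrict_of_monotoneOn measurableSet_Icc hq)
  have hre := real _ ((Complex.reCLM.lipschitz).comp_boundedVariationOn hf)
  have him := real _ ((Complex.imCLM.lipschitz).comp_boundedVariationOn hf)
  refine AEMeasurable.aestronglyMeasurable ?_
  exact aemeasurable_of_re_im hre him

theorem variationOnFromTo.dist_le_sub {α E : Type*} [LinearOrder α] [PseudoMetricSpace E]
    {f : α → E} {s : Set α} (hf : LocallyBoundedVariationOn f s) {a x y : α} (ha : a ∈ s)
    (hx : x ∈ s) (hy : y ∈ s) (hxy : x ≤ y) :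
    dist (f x) (f y) ≤ variationOnFromTo f s a y - variationOnFromTo f s a x := by
  rw [variationOnFromTo.sub_right hf ha hy hx, variationOnFromTo.eq_of_le f s hxy, dist_edist]
  exact ENNReal.toReal_mono (hf _ _ hx hy)
    (eVariationOn.edist_le f (s := s ∩ Icc x y) ⟨hx, le_rfl, hxy⟩ ⟨hy, hxy, le_rfl⟩)

theorem BoundedVariationOn.intervalIntegrable_Icc (hf : BoundedVariationOn f (Icc a b))
    (hab : a ≤ b) : IntervalIntegrable f volume a b := by
  obtain ⟨M, -, hM⟩ := hf.exists_norm_le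
  rw [intervalIntegrable_iff_integrableOn_Icc_of_le hab]
  refine Integrable.of_bound hf.aestronglyMeasurable_Icc M ?_
  rw [ae_restrict_iff' measurableSet_Icc]
  exact Filter.Eventually.of_forall hM

/-- One step of the summation by parts behind
`BoundedVariationOn.exists_norm_integral_mul_exp_le`. -/
theorem BoundedVariationOn.norm_integral_mul_exp_sub_le (hf : BoundedVariationOn f (Icc a b))
    {κ : ℂ} (hκ : κ ≠ 0) {B : ℝ} (hB : ∀ s ∈ Icc a b, ‖Complex.exp (κ * s)‖ ≤ B) {x y : ℝ}
    (hx : x ∈ Icc a b) (hy : y ∈ Icc a b) (hxy : x ≤ y) :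
    ‖(∫ s in x..y, f s * Complex.exp (κ * s))
        - (f y * Complex.exp (κ * y) - f x * Complex.exp (κ * x)) / κ‖
      ≤ (variationOnFromTo f (Icc a b) a y - variationOnFromTo f (Icc a b) a x)
          * (B * (y - x + ‖κ‖⁻¹)) := by
  have hab : a ≤ b := hx.1.trans hx.2
  have ha : a ∈ Icc a b := left_mem_Icc.2 hab
  have hl := hf.locallyBoundedVariationOn
  have hB0 : 0 ≤ B := (norm_nonneg _).trans (hB x hx)
  set V := variationOnFromTo f (Icc a b) a with hV
  have hcont : Continuous fun s : ℝ => Complex.exp (κ * s) := by fun_prop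
  have hfi : IntervalIntegrable f volume x y := (hf.intervalIntegrable_Icc hab).mono_set (by
    rw [uIcc_of_le hab, uIcc_of_le hxy]; exact Icc_subset_Icc hx.1 hy.2)
  have hexp : ∫ s in x..y, Complex.exp (κ * s)
      = (Complex.exp (κ * y) - Complex.exp (κ * x)) / κ := integral_exp_mul_complex hκ
  have h1 : (∫ s in x..y, f s * Complex.exp (κ * s))
      = (∫ s in x..y, (f s - f x) * Complex.exp (κ * s))
        + f x * ((Complex.exp (κ * y) - Complex.exp (κ * x)) / κ) := by
    rw [← hexp, ← intervalIntegral.integral_const_mul, ← intervalIntegral.integral_add]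
    · congr 1; ext s; ring
    · exact (hfi.sub intervalIntegrable_const).mul_continuousOn hcont.continuousOn
    · exact (hcont.const_mul _ |>.intervalIntegrable _ _)
  -- With `f` frozen at the left endpoint, the boundary term is written so that it telescopes over
  -- adjacent intervals. Both remaining terms are controlled by the variation of `f` on `[x, y]`.
  have h2 : (∫ s in x..y, f s * Complex.exp (κ * s))
        - (f y * Complex.exp (κ * y) - f x * Complex.exp (κ * x)) / κ
      = (∫ s in x..y, (f s - f x) * Complex.exp (κ * s))
        + (f x - f y) * Complex.exp (κ * y) / κ := by
    rw [h1]; ring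
  have hmono : ∀ s ∈ Icc a b, x ≤ s → s ≤ y → ‖f s - f x‖ ≤ V y - V x := by
    intro s hs hxs hsy
    have h3 := variationOnFromTo.dist_le_sub hl ha hx hs hxs
    have h4 := variationOnFromTo.monotoneOn hl ha hs hy hsy
    rw [dist_comm, dist_eq_norm] at h3
    linarith
  have hV0 : 0 ≤ V y - V x := (norm_nonneg _).trans (hmono y hy hxy le_rfl)
  rw [h2]
  refine (norm_add_le _ _).trans ?_
  have h5 : ‖∫ s in x..y, (f s - f x) * Complex.exp (κ * s)‖ ≤ (V y - V x) * B * |y - x| := by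
    refine intervalIntegral.norm_integral_le_of_norm_le_const fun s hs => ?_
    rw [uIoc_of_le hxy] at hs
    have hs' : s ∈ Icc a b := ⟨hx.1.trans hs.1.le, hs.2.trans hy.2⟩
    rw [norm_mul]
    exact mul_le_mul (hmono s hs' hs.1.le hs.2) (hB s hs') (norm_nonneg _) hV0
  have h6 : ‖(f x - f y) * Complex.exp (κ * y) / κ‖ ≤ (V y - V x) * B * ‖κ‖⁻¹ := by
    rw [norm_div, norm_mul, div_eq_mul_inv, norm_sub_rev]
    gcongr
    · exact hmono y hy hxy le_rfl
    · exact hB y hy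
  rw [abs_of_nonneg (by linarith)] at h5
  linarith

/-- The integrals of a function of bounded variation against `exp (κ s)` are `O(1/κ)`, as long as
`exp (κ s)` stays bounded. -/
theorem BoundedVariationOn.exists_norm_integral_mul_exp_le (hf : BoundedVariationOn f (Icc a b))
    (B : ℝ) : ∃ C, 0 ≤ C ∧ ∀ κ : ℂ, κ ≠ 0 → (∀ s ∈ Icc a b, ‖Complex.exp (κ * s)‖ ≤ B) →
      ∀ x ∈ Icc a b, ‖∫ s in a..x, f s * Complex.exp (κ * s)‖ ≤ C / ‖κ‖ := by
  obtain ⟨M, hM0, hM⟩ := hf.exists_norm_le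
  set V := variationOnFromTo f (Icc a b) a with hV
  refine ⟨|V b * (B * 2)| + 2 * |M * B|, by positivity, fun κ hκ hB x hx => ?_⟩
  have hab : a ≤ b := hx.1.trans hx.2
  have ha : a ∈ Icc a b := left_mem_Icc.2 hab
  have hl := hf.locallyBoundedVariationOn
  have hB0 : 0 ≤ B := (norm_nonneg _).trans (hB x hx)
  have hκ' : 0 < ‖κ‖ := norm_pos_iff.2 hκ
  -- `N` equal steps of length `d ≤ 1/‖κ‖`: each then contributes at most its share of the variation
  -- times `2B/‖κ‖`, so the total does not depend on `N`.
  obtain ⟨N, hN⟩ := exists_nat_gt ((x - a) * ‖κ‖)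
  have hNpos : (0 : ℝ) < N := lt_of_le_of_lt (mul_nonneg (sub_nonneg.2 hx.1) hκ'.le) hN
  set d := (x - a) / N with hd
  have hd0 : 0 ≤ d := div_nonneg (sub_nonneg.2 hx.1) hNpos.le
  have hdN : N * d = x - a := by rw [hd]; field_simp
  have hdκ : d ≤ ‖κ‖⁻¹ := by
    rw [hd, div_le_iff₀ hNpos, ← div_eq_inv_mul, le_div_iff₀ hκ']; exact hN.le
  have hmem : ∀ k : ℕ, k ≤ N → a + k * d ∈ Icc a b := by
    intro k hk
    have : (k : ℝ) * d ≤ N * d := by gcongr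
    exact ⟨by linarith [mul_nonneg (Nat.cast_nonneg (α := ℝ) k) hd0], by linarith [hx.2]⟩
  have hi : ∀ y ∈ Icc a b, ∀ z ∈ Icc a b,
      IntervalIntegrable (fun s => f s * Complex.exp (κ * s)) volume y z := by
    intro y hy z hz
    refine ((hf.intervalIntegrable_Icc hab).mono_set ?_).mul_continuousOn
      (Continuous.continuousOn (by fun_prop))
    rw [uIcc_of_le hab]; exact uIcc_subset_Icc hy hz
  have key : ∀ k : ℕ, k ≤ N →
      ‖(∫ s in a..(a + k * d), f s * Complex.exp (κ * s))
        - (f (a + k * d) * Complex.exp (κ * ↑(a + k * d)) - f a * Complex.exp (κ * a)) / κ‖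
      ≤ V (a + k * d) * (B * (2 * ‖κ‖⁻¹)) := by
    intro k
    induction k with
    | zero => intro _; simp [hV, variationOnFromTo.self]
    | succ k ih =>
      intro hk
      have h1 := ih (by omega)
      have hk1 := hmem k (by omega)
      have hk2 := hmem (k + 1) hk
      have hle : a + k * d ≤ a + (k + 1 : ℕ) * d := by push_cast; linarith
      have h2 := hf.norm_integral_mul_exp_sub_le hκ hB hk1 hk2 hle
      rw [← intervalIntegral.integral_add_adjacent_intervals (hi a ha _ hk1) (hi _ hk1 _ hk2)]
      have h3 : V (a + k * d) ≤ V (a + (k + 1 : ℕ) * d) :=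
        variationOnFromTo.monotoneOn hl ha hk1 hk2 hle
      have h4 : a + (k + 1 : ℕ) * d - (a + k * d) + ‖κ‖⁻¹ ≤ 2 * ‖κ‖⁻¹ := by
        push_cast; linarith
      have h5 := h2.trans (mul_le_mul_of_nonneg_left (mul_le_mul_of_nonneg_left h4 hB0)
        (sub_nonneg.2 h3))
      refine le_trans (le_of_eq ?_) ((norm_add_le _ _).trans ((add_le_add h1 h5).trans
        (le_of_eq ?_)))
      · congr 1; ring
      · ring
  have h1 := key N le_rfl
  rw [hdN, add_sub_cancel] at h1
  have h2 : V x ≤ V b := variationOnFromTo.monotoneOn hl ha hx (right_mem_Icc.2 hab) hx.2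
  have h3 : ‖(f x * Complex.exp (κ * x) - f a * Complex.exp (κ * a)) / κ‖
      ≤ (M * B + M * B) / ‖κ‖ := by
    rw [norm_div]
    gcongr
    refine (norm_sub_le _ _).trans ?_
    rw [norm_mul, norm_mul]
    exact add_le_add (mul_le_mul (hM x hx) (hB x hx) (norm_nonneg _) hM0)
      (mul_le_mul (hM a ha) (hB a ha) (norm_nonneg _) hM0)
  have h4 : V x * (B * (2 * ‖κ‖⁻¹)) ≤ |V b * (B * 2)| / ‖κ‖ := by
    rw [div_eq_mul_inv]
    calc V x * (B * (2 * ‖κ‖⁻¹)) ≤ V b * (B * (2 * ‖κ‖⁻¹)) := by gcongr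
      _ = V b * (B * 2) * ‖κ‖⁻¹ := by ring
      _ ≤ _ := by gcongr; exact le_abs_self _
  have h5 : (M * B + M * B) / ‖κ‖ ≤ 2 * |M * B| / ‖κ‖ := by
    gcongr; linarith [le_abs_self (M * B)]
  rw [add_div]
  linarith [norm_le_norm_sub_add (∫ s in a..x, f s * Complex.exp (κ * s))
    ((f x * Complex.exp (κ * x) - f a * Complex.exp (κ * a)) / κ)]

end BoundedVariation

/-! ### Volterra operators and invertibility of `1 - T` -/

section Volterra

variable {V : Type*} [NormedAddCommGroup V] [NormedSpace ℂ V] {L M : ℝ} {A : ℝ → V →L[ℂ] V}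

theorem intervalIntegrable_clm_apply (hL : 0 ≤ L)
    (hA : AEStronglyMeasurable A (volume.restrict (Icc 0 L))) (hM : ∀ x ∈ Icc 0 L, ‖A x‖ ≤ M)
    {f : ℝ → V} (hf : ContinuousOn f (Icc 0 L)) :
    IntervalIntegrable (fun s => A s (f s)) volume 0 L := by
  obtain ⟨K, hK⟩ := isCompact_Icc.exists_bound_of_continuousOn hf
  rw [intervalIntegrable_iff_integrableOn_Icc_of_le hL]
  refine Integrable.of_bound (C := M * K) ?_ ?_
  · exact (ContinuousLinearMap.id ℂ (V →L[ℂ] V)).aestronglyMeasurable_comp₂ hA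
      (hf.aestronglyMeasurable measurableSet_Icc)
  · rw [ae_restrict_iff' measurableSet_Icc]
    refine Filter.Eventually.of_forall fun x hx => ?_
    refine ((A x).le_opNorm _).trans ?_
    exact mul_le_mul (hM x hx) (hK x hx) (norm_nonneg _) ((norm_nonneg _).trans (hM x hx))

theorem continuousOn_volterra (hL : 0 ≤ L)
    (hA : AEStronglyMeasurable A (volume.restrict (Icc 0 L))) (hM : ∀ x ∈ Icc 0 L, ‖A x‖ ≤ M)
    {f : ℝ → V} (hf : ContinuousOn f (Icc 0 L)) :
    ContinuousOn (fun x => ∫ s in (0 : ℝ)..x, A s (f s)) (Icc 0 L) := by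
  have h := intervalIntegral.continuousOn_primitive_interval'
    (intervalIntegrable_clm_apply hL hA hM hf) left_mem_uIcc
  rwa [uIcc_of_le hL] at h

/-- The function underlying the Volterra operator `volterra`. -/
def volterraFun (hL : 0 ≤ L) (hA : AEStronglyMeasurable A (volume.restrict (Icc 0 L)))
    (hM : ∀ x ∈ Icc 0 L, ‖A x‖ ≤ M) (f : C(Icc 0 L, V)) : C(Icc 0 L, V) where
  toFun := fun x => ∫ s in (0 : ℝ)..x, A s (IccExtend hL f s)
  continuous_toFun :=
    (continuousOn_volterra hL hA hM f.continuous.Icc_extend'.continuousOn).comp_continuous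
      continuous_subtype_val fun x => x.2

theorem volterraFun_apply (hL : 0 ≤ L) (hA : AEStronglyMeasurable A (volume.restrict (Icc 0 L)))
    (hM : ∀ x ∈ Icc 0 L, ‖A x‖ ≤ M) (f : C(Icc 0 L, V)) (x : Icc 0 L) :
    volterraFun hL hA hM f x = ∫ s in (0 : ℝ)..x, A s (IccExtend hL f s) := rfl

/-- The Volterra integral operator `f ↦ (x ↦ ∫₀ˣ A(s) f(s) ds)` on `C([0, L], V)`, for a bounded
measurable operator-valued function `A`. -/
def volterra (hL : 0 ≤ L) (hA : AEStronglyMeasurable A (volume.restrict (Icc 0 L)))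
    (hM : ∀ x ∈ Icc 0 L, ‖A x‖ ≤ M) : C(Icc 0 L, V) →L[ℂ] C(Icc 0 L, V) :=
  have hi (f : C(Icc 0 L, V)) (x : Icc 0 L) :
      IntervalIntegrable (fun s => A s (IccExtend hL f s)) volume 0 x :=
    (intervalIntegrable_clm_apply hL hA hM f.continuous.Icc_extend'.continuousOn).mono_set (by
      rw [uIcc_of_le hL, uIcc_of_le x.2.1]; exact Icc_subset_Icc_right x.2.2)
  LinearMap.mkContinuous
    { toFun := volterraFun hL hA hM
      map_add' := fun f g => by
        ext x
        rw [ContinuousMap.add_apply, volterraFun_apply, volterraFun_apply, volterraFun_apply,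
          ← intervalIntegral.integral_add (hi f x) (hi g x)]
        simp [IccExtend, map_add]
      map_smul' := fun r f => by
        ext x
        rw [RingHom.id_apply, ContinuousMap.smul_apply, volterraFun_apply, volterraFun_apply,
          ← intervalIntegral.integral_smul]
        simp [IccExtend, map_smul] }
    (M * L) fun f => by
      have hM0 : 0 ≤ M := (norm_nonneg _).trans (hM 0 (left_mem_Icc.2 hL))
      rw [ContinuousMap.norm_le _ (by positivity)]
      intro x
      refine (intervalIntegral.norm_integral_le_of_norm_le_const (C := M * ‖f‖) ?_).trans ?_
      · intro s hs
        rw [uIoc_of_le x.2.1] at hs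
        refine ((A s).le_opNorm _).trans ?_
        exact mul_le_mul (hM s ⟨hs.1.le, hs.2.trans x.2.2⟩) (f.norm_coe_le_norm _)
          (norm_nonneg _) hM0
      · rw [sub_zero, abs_of_nonneg x.2.1]
        nlinarith [x.2.2, mul_nonneg hM0 (norm_nonneg f)]

theorem volterra_apply (hL : 0 ≤ L) (hA : AEStronglyMeasurable A (volume.restrict (Icc 0 L)))
    (hM : ∀ x ∈ Icc 0 L, ‖A x‖ ≤ M) (f : C(Icc 0 L, V)) (x : Icc 0 L) :
    volterra hL hA hM f x = ∫ s in (0 : ℝ)..x, A s (IccExtend hL f s) := rfl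

/-- The pointwise power `x ^ n` is kept for the induction: integrating it yields the factor
`1/(n+1)` that builds the factorial. -/
theorem norm_volterra_pow_apply_le (hL : 0 ≤ L)
    (hA : AEStronglyMeasurable A (volume.restrict (Icc 0 L))) (hM : ∀ x ∈ Icc 0 L, ‖A x‖ ≤ M)
    (n : ℕ) (f : C(Icc 0 L, V)) (x : Icc 0 L) :
    ‖(volterra hL hA hM ^ n) f x‖ ≤ ‖f‖ * ((M * x) ^ n / n.factorial) := by
  have hM0 : 0 ≤ M := (norm_nonneg _).trans (hM 0 (left_mem_Icc.2 hL))
  induction n generalizing x with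
  | zero => simpa using f.norm_coe_le_norm x
  | succ n ih =>
    rw [pow_succ', mul_apply_eq_comp, volterra_apply]
    have h1 : ‖∫ s in (0 : ℝ)..x, A s (IccExtend hL ((volterra hL hA hM ^ n) f) s)‖
        ≤ ∫ s in (0 : ℝ)..x, (M * (‖f‖ * (M ^ n / n.factorial))) * s ^ n := by
      refine intervalIntegral.norm_integral_le_of_norm_le x.2.1 ?_
        (Continuous.intervalIntegrable (by fun_prop) _ _)
      refine Filter.Eventually.of_forall fun s hs => ?_
      have hs' : s ∈ Icc 0 L := ⟨hs.1.le, hs.2.trans x.2.2⟩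
      refine ((A s).le_opNorm _).trans ?_
      rw [IccExtend_of_mem _ _ hs']
      refine (mul_le_mul (hM s hs') (ih ⟨s, hs'⟩) (norm_nonneg _) hM0).trans (le_of_eq ?_)
      simp only [mul_pow]
      ring
    refine h1.trans (le_of_eq ?_)
    rw [intervalIntegral.integral_const_mul, integral_pow, Nat.factorial_succ]
    push_cast
    field_simp
    simp only [ne_eq, Nat.add_eq_zero_iff, one_ne_zero, and_false, not_false_eq_true, zero_pow,
      sub_zero]
    ring

/-- `T` need not be a contraction, but the factorial makes some power `T ^ n` one. Then `1 - T ^ n`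
is invertible, and `1 - T` is one of its commuting factors. -/
theorem isUnit_one_sub_volterra [CompleteSpace V] (hL : 0 ≤ L)
    (hA : AEStronglyMeasurable A (volume.restrict (Icc 0 L))) (hM : ∀ x ∈ Icc 0 L, ‖A x‖ ≤ M) :
    IsUnit (1 - volterra hL hA hM) := by
  have hM0 : 0 ≤ M := (norm_nonneg _).trans (hM 0 (left_mem_Icc.2 hL))
  set T := volterra hL hA hM with hT
  obtain ⟨n, hn⟩ : ∃ n : ℕ, (M * L) ^ n / n.factorial < 1 :=
    ((FloorSemiring.tendsto_pow_div_factorial_atTop (M * L)).eventually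
      (gt_mem_nhds one_pos)).exists
  have hnorm : ‖T ^ n‖ < 1 := by
    refine lt_of_le_of_lt (ContinuousLinearMap.opNorm_le_bound _ (by positivity) fun f => ?_) hn
    rw [ContinuousMap.norm_le _ (by positivity)]
    intro x
    refine (norm_volterra_pow_apply_le hL hA hM n f x).trans ?_
    rw [mul_comm]
    have := x.2.1
    have := x.2.2
    gcongr
  have h1 : IsUnit (1 - T ^ n) := (Units.oneSub (T ^ n) hnorm).isUnit
  rw [← mul_neg_geom_sum T n] at h1
  refine (Commute.isUnit_mul_iff ?_).1 h1 |>.1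
  rw [commute_iff_eq, mul_neg_geom_sum, geom_sum_mul_neg]

end Volterra

/-! ### Auxiliary facts on absolute continuity and inverses -/

theorem AbsolutelyContinuousOnInterval.lipschitzWith_comp {X Y : Type*} [PseudoMetricSpace X]
    [PseudoMetricSpace Y] {f : ℝ → X} {g : X → Y} {K : NNReal} {a b : ℝ} (hg : LipschitzWith K g)
    (hf : AbsolutelyContinuousOnInterval f a b) :
    AbsolutelyContinuousOnInterval (fun x => g (f x)) a b := by
  rw [absolutelyContinuousOnInterval_iff] at hf ⊢
  intro ε hε
  obtain ⟨δ, hδ, h⟩ := hf (ε / (K + 1)) (by positivity)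
  refine ⟨δ, hδ, fun E hE hl => ?_⟩
  refine lt_of_le_of_lt (b := K * (ε / (K + 1))) ?_ ?_
  · refine le_trans ?_ (mul_le_mul_of_nonneg_left (h E hE hl).le K.2)
    rw [Finset.mul_sum]
    exact Finset.sum_le_sum fun i _ => hg.dist_le_mul _ _
  · rw [mul_div_assoc', div_lt_iff₀ (by positivity)]
    nlinarith

theorem AbsolutelyContinuousOnInterval.apply {n : ℕ} {f : ℝ → Fin n → ℂ} {a b : ℝ}
    (hf : AbsolutelyContinuousOnInterval f a b) (i : Fin n) :
    AbsolutelyContinuousOnInterval (fun x => f x i) a b :=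
  AbsolutelyContinuousOnInterval.lipschitzWith_comp (g := fun v : Fin n → ℂ => v i) (K := 1)
    (LipschitzWith.eval i) hf

theorem AbsolutelyContinuousOnInterval.mul_complex {f g : ℝ → ℂ} {a b : ℝ}
    (hf : AbsolutelyContinuousOnInterval f a b) (hg : AbsolutelyContinuousOnInterval g a b) :
    AbsolutelyContinuousOnInterval (fun x => f x * g x) a b := by
  have h := hf.fun_smul hg
  simpa only [smul_eq_mul] using h

theorem differentiable_inverse_one_sub_add_smul {R : Type*} [NormedRing R] [NormedAlgebra ℂ R]
    [CompleteSpace R] (a b : R) (h : ∀ z : ℂ, IsUnit (1 - (a + z • b))) :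
    Differentiable ℂ fun z : ℂ => Ring.inverse (1 - (a + z • b)) := by
  intro z
  have h1 : DifferentiableAt ℂ (fun z : ℂ => 1 - (a + z • b)) z := by fun_prop
  exact DifferentiableAt.fun_comp' z (differentiableAt_inverse (𝕜 := ℂ) (h z)) h1

/-! ### The initial value problem: existence, uniqueness, holomorphy in `lam` -/

namespace Dirac

variable {p q : ℝ → ℂ} {lam : ℂ}

/-- The operator of multiplication by a fixed matrix. -/
def matrixCLM (X : Matrix (Fin 2) (Fin 2) ℂ) : (Fin 2 → ℂ) →L[ℂ] (Fin 2 → ℂ) :=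
  LinearMap.toContinuousLinearMap X.mulVecLin

theorem matrixCLM_apply (X : Matrix (Fin 2) (Fin 2) ℂ) (v : Fin 2 → ℂ) :
    matrixCLM X v = X *ᵥ v := rfl

/-- The Dirac equation in the form `y' = coeff p q lam x y`. -/
def coeff (p q : ℝ → ℂ) (lam : ℂ) (x : ℝ) : (Fin 2 → ℂ) →L[ℂ] (Fin 2 → ℂ) :=
  (p x • matrixCLM !![0, -1; -1, 0] + q x • matrixCLM !![1, 0; 0, -1])
    + lam • matrixCLM !![0, -1; 1, 0]

theorem coeff_apply (x : ℝ) (v : Fin 2 → ℂ) : coeff p q lam x v =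
    ![q x * v 0 - (lam + p x) * v 1, (lam - p x) * v 0 - q x * v 1] := by
  ext i
  fin_cases i <;>
  simp [coeff, matrixCLM_apply, dotProduct, Fin.sum_univ_two] <;> ring

theorem equation_iff (x : ℝ) (v w : Fin 2 → ℂ) :
    J *ᵥ w + Q p q x *ᵥ v = lam • v ↔ w = coeff p q lam x v := by
  rw [coeff_apply]
  simp only [funext_iff, Fin.forall_fin_two, J, Q, Matrix.mulVec, dotProduct, Fin.sum_univ_two,
    Pi.add_apply, Pi.smul_apply, smul_eq_mul, Matrix.cons_val_zero, Matrix.cons_val_one,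
    Matrix.of_apply, Matrix.cons_val', Matrix.cons_val_fin_one]
  constructor
  · rintro ⟨h1, h2⟩
    exact ⟨by linear_combination -h2, by linear_combination h1⟩
  · rintro ⟨h1, h2⟩
    exact ⟨by linear_combination h2, by linear_combination -h1⟩

theorem isSolution_iff_ae {y : ℝ → Fin 2 → ℂ} : IsSolution p q lam y ↔
    AbsolutelyContinuousOnInterval y 0 π ∧
      ∀ᵐ x, x ∈ Icc 0 π → HasDerivAt y (coeff p q lam x (y x)) x := by
  rw [IsSolution, ae_restrict_iff' measurableSet_Icc]
  refine and_congr_right fun _ => Filter.eventually_congr (Filter.Eventually.of_forall fun x => ?_)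
  refine imp_congr_right fun _ => ?_
  rw [equation_iff]
  exact ⟨fun h => h.2 ▸ h.1.hasDerivAt, fun h => ⟨h.differentiableAt, h.deriv⟩⟩

theorem aestronglyMeasurable_coeff (hp : BoundedVariationOn p (Icc 0 π))
    (hq : BoundedVariationOn q (Icc 0 π)) (lam : ℂ) :
    AEStronglyMeasurable (coeff p q lam) (volume.restrict (Icc 0 π)) :=
  ((hp.aestronglyMeasurable_Icc.smul_const _).add (hq.aestronglyMeasurable_Icc.smul_const _)).add
    aestronglyMeasurable_const

theorem exists_norm_coeff_le (hp : BoundedVariationOn p (Icc 0 π))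
    (hq : BoundedVariationOn q (Icc 0 π)) :
    ∃ M : ℂ → ℝ, ∀ lam, ∀ x ∈ Icc 0 π, ‖coeff p q lam x‖ ≤ M lam := by
  obtain ⟨Mp, hp0, hMp⟩ := hp.exists_norm_le
  obtain ⟨Mq, hq0, hMq⟩ := hq.exists_norm_le
  refine ⟨fun lam => Mp * ‖matrixCLM !![0, -1; -1, 0]‖ + Mq * ‖matrixCLM !![1, 0; 0, -1]‖
    + ‖lam‖ * ‖matrixCLM !![0, -1; 1, 0]‖, fun lam x hx => ?_⟩
  refine (norm_add_le _ _).trans (add_le_add ((norm_add_le _ _).trans (add_le_add ?_ ?_)) ?_)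
  · rw [norm_smul]; gcongr; exact hMp x hx
  · rw [norm_smul]; gcongr; exact hMq x hx
  · rw [norm_smul]

/-- A continuous `y` has a bounded right-hand side, so the almost-everywhere equation and the
Volterra equation are equivalent by the fundamental theorem above. -/
theorem isSolution_iff_integral (hp : BoundedVariationOn p (Icc 0 π))
    (hq : BoundedVariationOn q (Icc 0 π)) {y : ℝ → Fin 2 → ℂ} :
    IsSolution p q lam y ↔ ContinuousOn y (Icc 0 π) ∧
      ∀ x ∈ Icc 0 π, y x = y 0 + ∫ s in (0 : ℝ)..x, coeff p q lam s (y s) := by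
  have hA := aestronglyMeasurable_coeff hp hq lam
  obtain ⟨M', hM'⟩ := exists_norm_coeff_le hp hq
  set M := M' lam
  have hM := hM' lam
  have hM0 : 0 ≤ M := (norm_nonneg _).trans (hM 0 (left_mem_Icc.2 Real.pi_nonneg))
  have hbound : ∀ {y : ℝ → Fin 2 → ℂ}, ContinuousOn y (Icc 0 π) →
      ∃ K, 0 ≤ K ∧ ∀ x ∈ Icc 0 π, ‖coeff p q lam x (y x)‖ ≤ K := by
    intro y hy
    obtain ⟨K, hK⟩ := isCompact_Icc.exists_bound_of_continuousOn hy
    have hK0 : 0 ≤ K := (norm_nonneg _).trans (hK 0 (left_mem_Icc.2 Real.pi_nonneg))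
    exact ⟨M * K, by positivity, fun x hx => ((coeff p q lam x).le_opNorm _).trans
      (mul_le_mul (hM x hx) (hK x hx) (norm_nonneg _) hM0)⟩
  rw [isSolution_iff_ae]
  constructor
  · rintro ⟨hac, hd⟩
    have hc : ContinuousOn y (Icc 0 π) := by
      have := hac.continuousOn
      rwa [uIcc_of_le Real.pi_nonneg] at this
    obtain ⟨K, -, hK⟩ := hbound hc
    refine ⟨hc, fun x hx => ?_⟩
    have h1 := (hac.sub_eq_integral_deriv (K := K) Real.pi_nonneg (by
      filter_upwards [hd] with s hs hm
      refine ⟨(hs hm).differentiableAt, ?_⟩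
      rw [(hs hm).deriv]
      exact hK s hm)).2 x hx
    rw [← sub_eq_iff_eq_add', h1]
    refine intervalIntegral.integral_congr_ae ?_
    filter_upwards [hd] with s hs hm
    rw [uIoc_of_le hx.1] at hm
    exact (hs ⟨hm.1.le, hm.2.trans hx.2⟩).deriv
  · rintro ⟨hc, hy⟩
    obtain ⟨K, hK0, hK⟩ := hbound hc
    have hi := intervalIntegrable_clm_apply Real.pi_nonneg hA hM hc
    have hl := lipschitzOnWith_integral_of_ae_norm_le Real.pi_nonneg hK0 hi
      (Filter.Eventually.of_forall hK)
    constructor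
    · refine LipschitzOnWith.absolutelyContinuousOnInterval (K := K.toNNReal) ?_
      intro x hx z hz
      rw [uIcc_of_le Real.pi_nonneg] at hx hz
      rw [hy x hx, hy z hz, edist_add_left]
      exact hl (by rwa [uIcc_of_le Real.pi_nonneg]) (by rwa [uIcc_of_le Real.pi_nonneg])
    -- The integral equation says nothing outside `[0, π]`, so two-sided differentiability is only
    -- available in the interior; the endpoints form a null set.
    · have h0 : ∀ᵐ x : ℝ, x ≠ 0 := by simp [ae_iff, measure_singleton]
      have hπ : ∀ᵐ x : ℝ, x ≠ π := by simp [ae_iff, measure_singleton]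
      filter_upwards [hi.ae_hasDerivAt_integral, h0, hπ] with x hx hx0 hxπ hm
      have h1 := (hx (by rwa [uIcc_of_le Real.pi_nonneg]) 0 left_mem_uIcc).const_add (y 0)
      refine h1.congr_of_eventuallyEq ?_
      filter_upwards [Icc_mem_nhds (lt_of_le_of_ne hm.1 hx0.symm) (lt_of_le_of_ne hm.2 hxπ)]
        with z hz using hy z hz

theorem IsSolution.continuousOn {y : ℝ → Fin 2 → ℂ} (hy : IsSolution p q lam y) :
    ContinuousOn y (Icc 0 π) := by
  have := hy.1.continuousOn
  rwa [uIcc_of_le Real.pi_nonneg] at this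

theorem IsSolution.add {y z : ℝ → Fin 2 → ℂ} (hy : IsSolution p q lam y)
    (hz : IsSolution p q lam z) : IsSolution p q lam (fun x => y x + z x) := by
  rw [isSolution_iff_ae] at *
  refine ⟨hy.1.add hz.1, ?_⟩
  filter_upwards [hy.2, hz.2] with x h1 h2 hm
  rw [map_add]
  exact (h1 hm).add (h2 hm)

theorem IsSolution.const_smul {y : ℝ → Fin 2 → ℂ} (hy : IsSolution p q lam y) (r : ℂ) :
    IsSolution p q lam (fun x => r • y x) := by
  rw [isSolution_iff_ae] at *
  refine ⟨hy.1.const_smul r, ?_⟩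
  filter_upwards [hy.2] with x h1 hm
  rw [map_smul]
  exact (h1 hm).const_smul r

/-- The Wronskian of two solutions is constant. -/
theorem IsSolution.wronskian_eq {y z : ℝ → Fin 2 → ℂ} (hy : IsSolution p q lam y)
    (hz : IsSolution p q lam z) {x : ℝ} (hx : x ∈ Icc 0 π) :
    y x 0 * z x 1 - y x 1 * z x 0 = y 0 0 * z 0 1 - y 0 1 * z 0 0 := by
  rw [isSolution_iff_ae] at hy hz
  have hW : AbsolutelyContinuousOnInterval (fun x => y x 0 * z x 1 - y x 1 * z x 0) 0 π :=
    ((hy.1.apply 0).mul_complex (hz.1.apply 1)).sub ((hy.1.apply 1).mul_complex (hz.1.apply 0))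
  -- The derivative vanishes because the coefficient matrix has trace `q - q = 0`.
  have hd : ∀ᵐ s, s ∈ uIcc 0 π → HasDerivAt (fun x => y x 0 * z x 1 - y x 1 * z x 0) 0 s := by
    filter_upwards [hy.2, hz.2] with s h1 h2 hm
    rw [uIcc_of_le Real.pi_nonneg] at hm
    have h1 := hasDerivAt_pi.1 (h1 hm)
    have h2 := hasDerivAt_pi.1 (h2 hm)
    refine HasDerivAt.congr_deriv (((h1 0).mul (h2 1)).sub ((h1 1).mul (h2 0))) ?_
    simp only [coeff_apply, Matrix.cons_val_zero, Matrix.cons_val_one]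
    ring
  obtain ⟨C, hC⟩ := hW.const_of_ae_hasDerivAt_zero hd
  rw [uIcc_of_le Real.pi_nonneg] at hC
  exact (hC x hx).trans (hC 0 (left_mem_Icc.2 Real.pi_nonneg)).symm

/-- The solutions with a given initial value exist and depend holomorphically on the spectral
parameter; moreover they are unique. -/
theorem exists_holomorphic_solution (hp : BoundedVariationOn p (Icc 0 π))
    (hq : BoundedVariationOn q (Icc 0 π)) (v : Fin 2 → ℂ) :
    ∃ Y : ℂ → C(Icc 0 π, Fin 2 → ℂ), Differentiable ℂ Y ∧
      (∀ lam, IsSolution p q lam (IccExtend Real.pi_nonneg (Y lam)) ∧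
        IccExtend Real.pi_nonneg (Y lam) 0 = v) ∧
      ∀ lam y, IsSolution p q lam y → y 0 = v →
        EqOn y (IccExtend Real.pi_nonneg (Y lam)) (Icc 0 π) := by
  obtain ⟨M, hM⟩ := exists_norm_coeff_le hp hq
  have hA := aestronglyMeasurable_coeff hp hq
  let T : ℂ → C(Icc 0 π, Fin 2 → ℂ) →L[ℂ] C(Icc 0 π, Fin 2 → ℂ) := fun lam =>
    volterra Real.pi_nonneg (hA lam) (hM lam)
  have hT : ∀ lam f (x : Icc 0 π), T lam f x
      = ∫ s in (0 : ℝ)..x, coeff p q lam s (IccExtend Real.pi_nonneg f s) := fun _ _ _ => rfl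
  -- The spectral parameter enters affinely, so holomorphy of the solution reduces to that of the
  -- inverse of an affine operator family.
  have hlin : ∀ lam, T lam = T 0 + lam • (T 1 - T 0) := by
    intro lam
    ext1 f
    ext1 x
    have hi : ∀ lam, IntervalIntegrable
        (fun s => coeff p q lam s (IccExtend Real.pi_nonneg f s)) volume 0 x := fun lam =>
      (intervalIntegrable_clm_apply Real.pi_nonneg (hA lam) (hM lam)
        f.continuous.Icc_extend'.continuousOn).mono_set (by
          rw [uIcc_of_le Real.pi_nonneg, uIcc_of_le x.2.1]; exact Icc_subset_Icc_right x.2.2)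
    have h1 : (T 0 + lam • (T 1 - T 0)) f x = T 0 f x + lam • (T 1 f x - T 0 f x) := rfl
    rw [h1, hT, hT, hT, ← intervalIntegral.integral_sub (hi 1) (hi 0),
      ← intervalIntegral.integral_smul]
    refine Eq.trans ?_ (intervalIntegral.integral_add (hi 0) (((hi 1).sub (hi 0)).smul lam))
    congr 1
    ext1 s
    simp [coeff]
  have hunit : ∀ lam, IsUnit (1 - T lam) := fun lam =>
    isUnit_one_sub_volterra Real.pi_nonneg (hA lam) (hM lam)
  let v0 : C(Icc 0 π, Fin 2 → ℂ) := ContinuousMap.const _ v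
  let Y : ℂ → C(Icc 0 π, Fin 2 → ℂ) := fun lam => Ring.inverse (1 - T lam) v0
  have hY : ∀ lam, Y lam = v0 + T lam (Y lam) := by
    intro lam
    have h1 := congrArg (fun S => S v0) (Ring.mul_inverse_cancel _ (hunit lam))
    have h2 : Y lam - T lam (Y lam) = v0 := h1
    rw [← h2]; abel
  have hYx : ∀ lam, ∀ x ∈ Icc 0 π, IccExtend Real.pi_nonneg (Y lam) x
      = v + ∫ s in (0 : ℝ)..x, coeff p q lam s (IccExtend Real.pi_nonneg (Y lam) s) := by
    intro lam x hx
    rw [IccExtend_of_mem _ _ hx]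
    exact congrArg (fun f : C(Icc 0 π, Fin 2 → ℂ) => f ⟨x, hx⟩) (hY lam)
  have hY0 : ∀ lam, IccExtend Real.pi_nonneg (Y lam) 0 = v := by
    intro lam
    rw [hYx lam 0 (left_mem_Icc.2 Real.pi_nonneg)]
    simp
  refine ⟨Y, ?_, fun lam => ⟨?_, hY0 lam⟩, ?_⟩
  · intro lam
    have h1 := differentiable_inverse_one_sub_add_smul (T 0) (T 1 - T 0)
      (fun z => by rw [← hlin]; exact hunit z)
    have h2 : DifferentiableAt ℂ (fun lam => Ring.inverse (1 - T lam)) lam := by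
      refine (h1 lam).congr_of_eventuallyEq (Filter.Eventually.of_forall fun z => ?_)
      simp only [← hlin]
    exact h2.clm_apply (differentiableAt_const _)
  · rw [isSolution_iff_integral hp hq]
    refine ⟨(Y lam).continuous.Icc_extend'.continuousOn, fun x hx => ?_⟩
    rw [hY0 lam]
    exact hYx lam x hx
  · intro lam y hy hy0 x hx
    rw [isSolution_iff_integral hp hq] at hy
    let f : C(Icc 0 π, Fin 2 → ℂ) := ⟨fun x => y x, hy.1.comp_continuous continuous_subtype_val
      fun x => x.2⟩
    -- Uniqueness: any solution restricted to `[0, π]` solves the same Volterra equation, and `1 - T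
    -- lam` is injective.
    have hf : (1 - T lam) f = v0 := by
      ext1 z
      have h1 : (1 - T lam) f z = y z
          - ∫ s in (0 : ℝ)..z, coeff p q lam s (IccExtend Real.pi_nonneg f s) := rfl
      have h2 : ∫ s in (0 : ℝ)..z, coeff p q lam s (IccExtend Real.pi_nonneg f s)
          = ∫ s in (0 : ℝ)..z, coeff p q lam s (y s) := by
        refine intervalIntegral.integral_congr fun s hs => ?_
        rw [uIcc_of_le z.2.1] at hs
        have hs' : s ∈ Icc 0 π := ⟨hs.1, hs.2.trans z.2.2⟩
        simp only [IccExtend_of_mem _ _ hs']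
        rfl
      rw [h1, h2, hy.2 z z.2, hy0, add_sub_cancel_right]
      rfl
    have h3 : Y lam = f := by
      have h1 := congrArg (fun S => S f) (Ring.inverse_mul_cancel _ (hunit lam))
      have h2 : Ring.inverse (1 - T lam) ((1 - T lam) f) = f := h1
      rw [hf] at h2
      exact h2
    rw [h3, IccExtend_of_mem _ _ hx]
    rfl

/-- `solution` is an epsilon choice; it meets its specification only because some solution exists.
-/
theorem isSolution_solution (hp : BoundedVariationOn p (Icc 0 π))
    (hq : BoundedVariationOn q (Icc 0 π)) (lam : ℂ) (v : Fin 2 → ℂ) :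
    IsSolution p q lam (solution p q lam v) ∧ solution p q lam v 0 = v := by
  obtain ⟨Y, -, hY, -⟩ := exists_holomorphic_solution hp hq v
  exact Classical.epsilon_spec (p := fun y => IsSolution p q lam y ∧ y 0 = v) ⟨_, hY lam⟩

theorem IsSolution.eqOn (hp : BoundedVariationOn p (Icc 0 π))
    (hq : BoundedVariationOn q (Icc 0 π)) {y z : ℝ → Fin 2 → ℂ} (hy : IsSolution p q lam y)
    (hz : IsSolution p q lam z) (h0 : y 0 = z 0) : EqOn y z (Icc 0 π) := by
  obtain ⟨Y, -, -, hY⟩ := exists_holomorphic_solution hp hq (z 0)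
  exact fun x hx => (hY lam y hy h0 hx).trans (hY lam z hz rfl hx).symm

/-- `solution` is chosen separately for each `lam`, but by uniqueness its values on `[0, π]` agree
with those of the holomorphic family. -/
theorem differentiable_solution (hp : BoundedVariationOn p (Icc 0 π))
    (hq : BoundedVariationOn q (Icc 0 π)) (v : Fin 2 → ℂ) {x : ℝ} (hx : x ∈ Icc 0 π) (i : Fin 2) :
    Differentiable ℂ fun lam => solution p q lam v x i := by
  obtain ⟨Y, hYd, -, hY⟩ := exists_holomorphic_solution hp hq v
  have h1 : (fun lam => solution p q lam v x i) = fun lam => Y lam ⟨x, hx⟩ i := by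
    ext lam
    obtain ⟨h2, h3⟩ := isSolution_solution hp hq lam v
    rw [hY lam _ h2 h3 hx, IccExtend_of_mem _ _ hx]
  rw [h1]
  have h4 := (ContinuousLinearMap.proj (R := ℂ) (φ := fun _ : Fin 2 => ℂ) i).differentiable.comp
    ((ContinuousMap.evalCLM (M := Fin 2 → ℂ) ℂ (⟨x, hx⟩ : Icc 0 π)).differentiable.comp hYd)
  exact h4

end Dirac

/-! ### Perturbation estimates for the coupled system -/

/-- If `U' = α V` and `V' = β U`, where the primitive of `α` is small, then `U` is nearly
constant. -/
theorem norm_sub_le_of_coupled_system {U V α β : ℝ → ℂ} {L M N ε : ℝ} (hL : 0 ≤ L)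
    (hU : AbsolutelyContinuousOnInterval U 0 L) (hV : AbsolutelyContinuousOnInterval V 0 L)
    (hU' : ∀ᵐ x, x ∈ Icc 0 L → HasDerivAt U (α x * V x) x)
    (hV' : ∀ᵐ x, x ∈ Icc 0 L → HasDerivAt V (β x * U x) x)
    (hα : IntervalIntegrable α volume 0 L) (hαM : ∀ x ∈ Icc 0 L, ‖α x‖ ≤ M)
    (hβM : ∀ x ∈ Icc 0 L, ‖β x‖ ≤ M) (hαε : ∀ x ∈ Icc 0 L, ‖∫ s in (0 : ℝ)..x, α s‖ ≤ ε)
    (hUN : ∀ x ∈ Icc 0 L, ‖U x‖ ≤ N) (hVN : ∀ x ∈ Icc 0 L, ‖V x‖ ≤ N) {x : ℝ}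
    (hx : x ∈ Icc 0 L) : ‖U x - U 0‖ ≤ ε * (1 + L * M) * N := by
  have h0 : (0 : ℝ) ∈ Icc 0 L := left_mem_Icc.2 hL
  have hM0 : 0 ≤ M := (norm_nonneg _).trans (hαM 0 h0)
  have hN0 : 0 ≤ N := (norm_nonneg _).trans (hUN 0 h0)
  have hε0 : 0 ≤ ε := (norm_nonneg _).trans (hαε 0 h0)
  set A : ℝ → ℂ := fun x => ∫ s in (0 : ℝ)..x, α s with hA
  have hAac : AbsolutelyContinuousOnInterval A 0 L :=
    (lipschitzOnWith_integral_of_ae_norm_le hL hM0 hα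
      (Filter.Eventually.of_forall hαM)).absolutelyContinuousOnInterval
  -- Integration by parts: the terms `αV` cancel and `(U - AV)' = -AβU`, which carries the small
  -- factor `A`.
  have hW : AbsolutelyContinuousOnInterval (fun x => U x - A x * V x) 0 L :=
    hU.sub (hAac.mul_complex hV)
  have hW' : ∀ᵐ x, x ∈ Icc 0 L → DifferentiableAt ℝ (fun x => U x - A x * V x) x ∧
      ‖deriv (fun x => U x - A x * V x) x‖ ≤ ε * M * N := by
    filter_upwards [hU', hV', hα.ae_hasDerivAt_integral] with s h1 h2 h3 hs
    have h3 : HasDerivAt A (α s) s := h3 (by rwa [uIcc_of_le hL]) 0 left_mem_uIcc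
    have h4 : HasDerivAt (fun x => U x - A x * V x) (-(A s * β s * U s)) s := by
      refine HasDerivAt.congr_deriv ((h1 hs).sub (h3.mul (h2 hs))) ?_
      ring
    refine ⟨h4.differentiableAt, ?_⟩
    rw [h4.deriv, norm_neg, norm_mul, norm_mul]
    gcongr
    · exact hαε s hs
    · exact hβM s hs
    · exact hUN s hs
  have h1 := hW.norm_sub_le_of_ae_norm_deriv_le hL hW' hx
  have hA0 : A 0 = 0 := by simp [hA]
  simp only [hA0, zero_mul, sub_zero] at h1
  have h2 : ‖A x * V x‖ ≤ ε * N := by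
    rw [norm_mul]; exact mul_le_mul (hαε x hx) (hVN x hx) (norm_nonneg _) hε0
  have h3 : U x - U 0 = (U x - A x * V x - U 0) + A x * V x := by ring
  have h4 : ε * M * N * x ≤ ε * M * N * L := by gcongr; exact hx.2
  rw [h3]
  refine (norm_add_le _ _).trans ?_
  linarith

/-- Both components of a coupled system `U' = α V`, `V' = β U` are nearly constant if the
primitives of `α` and `β` are small. -/
theorem norm_sub_le_of_coupled_system_of_small {U V α β : ℝ → ℂ} {L M ε : ℝ} (hL : 0 ≤ L)
    (hU : AbsolutelyContinuousOnInterval U 0 L) (hV : AbsolutelyContinuousOnInterval V 0 L)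
    (hU' : ∀ᵐ x, x ∈ Icc 0 L → HasDerivAt U (α x * V x) x)
    (hV' : ∀ᵐ x, x ∈ Icc 0 L → HasDerivAt V (β x * U x) x)
    (hα : IntervalIntegrable α volume 0 L) (hβ : IntervalIntegrable β volume 0 L)
    (hαM : ∀ x ∈ Icc 0 L, ‖α x‖ ≤ M) (hβM : ∀ x ∈ Icc 0 L, ‖β x‖ ≤ M)
    (hαε : ∀ x ∈ Icc 0 L, ‖∫ s in (0 : ℝ)..x, α s‖ ≤ ε)
    (hβε : ∀ x ∈ Icc 0 L, ‖∫ s in (0 : ℝ)..x, β s‖ ≤ ε) (hε : ε * (1 + L * M) ≤ 1 / 2) {x : ℝ}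
    (hx : x ∈ Icc 0 L) :
    ‖U x - U 0‖ ≤ 2 * (ε * (1 + L * M)) * max ‖U 0‖ ‖V 0‖ ∧
      ‖V x - V 0‖ ≤ 2 * (ε * (1 + L * M)) * max ‖U 0‖ ‖V 0‖ := by
  have h0 : (0 : ℝ) ∈ Icc 0 L := left_mem_Icc.2 hL
  have hM0 : 0 ≤ M := (norm_nonneg _).trans (hαM 0 h0)
  have hε0 : 0 ≤ ε := (norm_nonneg _).trans (hαε 0 h0)
  have hUc : ContinuousOn U (Icc 0 L) := by
    have := hU.continuousOn; rwa [uIcc_of_le hL] at this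
  have hVc : ContinuousOn V (Icc 0 L) := by
    have := hV.continuousOn; rwa [uIcc_of_le hL] at this
  obtain ⟨z, hz, hmax⟩ := isCompact_Icc.exists_isMaxOn ⟨0, h0⟩ (hUc.norm.sup hVc.norm)
  set N := max ‖U z‖ ‖V z‖ with hN
  have hmax' : ∀ x ∈ Icc 0 L, max ‖U x‖ ‖V x‖ ≤ N := fun x hx => hmax hx
  have hUN : ∀ x ∈ Icc 0 L, ‖U x‖ ≤ N := fun x hx => (le_max_left _ _).trans (hmax' x hx)
  have hVN : ∀ x ∈ Icc 0 L, ‖V x‖ ≤ N := fun x hx => (le_max_right _ _).trans (hmax' x hx)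
  have hN0 : 0 ≤ N := (norm_nonneg _).trans (hUN 0 h0)
  have h1 : ∀ x ∈ Icc 0 L, ‖U x - U 0‖ ≤ ε * (1 + L * M) * N := fun x hx =>
    norm_sub_le_of_coupled_system hL hU hV hU' hV' hα hαM hβM hαε hUN hVN hx
  have h2 : ∀ x ∈ Icc 0 L, ‖V x - V 0‖ ≤ ε * (1 + L * M) * N := fun x hx =>
    norm_sub_le_of_coupled_system hL hV hU hV' hU' hβ hβM hαM hβε hVN hUN hx
  -- At the maximum point the estimate reads `N ≤ max ‖U 0‖ ‖V 0‖ + N/2`, and the last term is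
  -- absorbed.
  have h3 : N ≤ 2 * max ‖U 0‖ ‖V 0‖ := by
    have h4 : N ≤ max ‖U 0‖ ‖V 0‖ + ε * (1 + L * M) * N := by
      refine max_le ?_ ?_
      · linarith [h1 z hz, norm_le_norm_sub_add (U z) (U 0), le_max_left ‖U 0‖ ‖V 0‖]
      · linarith [h2 z hz, norm_le_norm_sub_add (V z) (V 0), le_max_right ‖U 0‖ ‖V 0‖]
    nlinarith
  have h4 : ε * (1 + L * M) * N ≤ 2 * (ε * (1 + L * M)) * max ‖U 0‖ ‖V 0‖ :=
    (mul_le_mul_of_nonneg_left h3 (by positivity)).trans (le_of_eq (by ring))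
  exact ⟨(h1 x hx).trans h4, (h2 x hx).trans h4⟩

theorem norm_exp_mul_ofReal_le {κ : ℂ} {R L x : ℝ} (hκ : |κ.re| ≤ R) (hx : x ∈ Icc 0 L) :
    ‖Complex.exp (κ * x)‖ ≤ Real.exp (R * L) := by
  rw [Complex.norm_exp]
  refine Real.exp_le_exp.2 ?_
  rw [Complex.re_mul_ofReal]
  have h1 := abs_nonneg κ.re
  calc κ.re * x ≤ |κ.re| * x := mul_le_mul_of_nonneg_right (le_abs_self _) hx.1
    _ ≤ R * L := mul_le_mul hκ hx.2 hx.1 (h1.trans hκ)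

/-! ### Asymptotics of solutions for large `lam` in a strip -/

namespace Dirac

variable {p q : ℝ → ℂ} {lam : ℂ}

/-- For large `lam` in a horizontal strip, every solution is close to a solution of the free
equation. -/
theorem exists_solution_asymptotics (hp : BoundedVariationOn p (Icc 0 π))
    (hq : BoundedVariationOn q (Icc 0 π)) (R : ℝ) :
    ∃ K Λ : ℝ, 0 < K ∧ 0 < Λ ∧ ∀ lam : ℂ, |lam.im| ≤ R → Λ ≤ ‖lam‖ →
      ∀ y, IsSolution p q lam y → ∀ x ∈ Icc 0 π,
        ‖y x 0 + Complex.I * y x 1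
            - Complex.exp (Complex.I * lam * x) * (y 0 0 + Complex.I * y 0 1)‖
          ≤ K / ‖lam‖ * ‖y 0‖ ∧
        ‖y x 0 - Complex.I * y x 1
            - Complex.exp (-(Complex.I * lam) * x) * (y 0 0 - Complex.I * y 0 1)‖
          ≤ K / ‖lam‖ * ‖y 0‖ := by
  obtain ⟨Mp, hMp0, hMp⟩ := hp.exists_norm_le
  obtain ⟨Mq, hMq0, hMq⟩ := hq.exists_norm_le
  set E := Real.exp (R * π) with hE
  have hE0 : 0 < E := Real.exp_pos _
  obtain ⟨Cp, hCp0, hCp⟩ := hp.exists_norm_integral_mul_exp_le (E * E)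
  obtain ⟨Cq, hCq0, hCq⟩ := hq.exists_norm_integral_mul_exp_le (E * E)
  set M := (Mq + Mp) * (E * E) with hM
  have hM0 : 0 ≤ M := by positivity
  set K := (Cq + Cp + 1) * (1 + π * M) with hK
  have hK0 : 0 < K := by have := Real.pi_pos; positivity
  -- `Λ = 2K` makes the smallness parameter `K/‖lam‖` at most `1/2`. In `4 * E * K`, one factor 2
  -- comes from the absorption above, another from `‖U 0‖, ‖V 0‖ ≤ 2‖y 0‖`, and `E` from undoing the
  -- exponential factor.
  refine ⟨4 * E * K, 2 * K, by positivity, by positivity, ?_⟩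
  intro lam hlam hΛ y hy x hx
  have hl0 : 0 < ‖lam‖ := lt_of_lt_of_le (by positivity) hΛ
  have hre1 : |(Complex.I * lam).re| ≤ R := by simpa using hlam
  have hre2 : |(-(Complex.I * lam)).re| ≤ R := by simpa using hlam
  have he1 : ∀ s ∈ Icc 0 π, ‖Complex.exp (Complex.I * lam * s)‖ ≤ E := fun s hs =>
    norm_exp_mul_ofReal_le hre1 hs
  have he2 : ∀ s ∈ Icc 0 π, ‖Complex.exp (-(Complex.I * lam) * s)‖ ≤ E := fun s hs =>
    norm_exp_mul_ofReal_le hre2 hs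
  -- Both coupling coefficients at once: `j = -i`, `κ = -2i lam` gives `α`, and `j = i`, `κ = 2i
  -- lam` gives `β`.
  have key : ∀ κ : ℂ, ‖κ‖ = 2 * ‖lam‖ → (∀ s ∈ Icc 0 π, ‖Complex.exp (κ * s)‖ ≤ E * E) →
      ∀ j : ℂ, ‖j‖ = 1 →
      IntervalIntegrable (fun s => (q s + j * p s) * Complex.exp (κ * s)) volume 0 π ∧
      (∀ s ∈ Icc 0 π, ‖(q s + j * p s) * Complex.exp (κ * s)‖ ≤ M) ∧
      ∀ z ∈ Icc 0 π, ‖∫ s in (0 : ℝ)..z, (q s + j * p s) * Complex.exp (κ * s)‖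
        ≤ (Cq + Cp + 1) / ‖lam‖ := by
    intro κ hκ hκE j hj
    have hκ0 : κ ≠ 0 := norm_pos_iff.1 (by rw [hκ]; positivity)
    have hcont : Continuous fun s : ℝ => Complex.exp (κ * s) := by fun_prop
    have hiq : IntervalIntegrable (fun s => q s * Complex.exp (κ * s)) volume 0 π :=
      (hq.intervalIntegrable_Icc Real.pi_nonneg).mul_continuousOn hcont.continuousOn
    have hip : IntervalIntegrable (fun s => j * (p s * Complex.exp (κ * s))) volume 0 π :=
      ((hp.intervalIntegrable_Icc Real.pi_nonneg).mul_continuousOn hcont.continuousOn).const_mul j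
    have hsum : (fun s => (q s + j * p s) * Complex.exp (κ * s))
        = fun s => q s * Complex.exp (κ * s) + j * (p s * Complex.exp (κ * s)) := by
      ext s; ring
    refine ⟨by rw [hsum]; exact hiq.add hip, fun s hs => ?_, fun z hz => ?_⟩
    · rw [norm_mul]
      refine mul_le_mul ((norm_add_le _ _).trans ?_) (hκE s hs) (norm_nonneg _) (by positivity)
      rw [norm_mul, hj, one_mul]
      exact add_le_add (hMq s hs) (hMp s hs)
    · have hsub : uIcc 0 z ⊆ uIcc 0 π := by
        rw [uIcc_of_le hz.1, uIcc_of_le Real.pi_nonneg]; exact Icc_subset_Icc_right hz.2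
      rw [hsum, intervalIntegral.integral_add (hiq.mono_set hsub) (hip.mono_set hsub),
        intervalIntegral.integral_const_mul]
      refine (norm_add_le _ _).trans ?_
      rw [norm_mul, hj, one_mul]
      refine (add_le_add (hCq κ hκ0 hκE z hz) (hCp κ hκ0 hκE z hz)).trans ?_
      rw [← add_div, hκ]
      exact div_le_div₀ (by positivity) (by linarith) hl0 (by linarith)
  have hα := key (-(Complex.I * lam) + -(Complex.I * lam))
    (by rw [← two_mul, norm_mul, norm_neg, norm_mul]; simp)
    (fun s hs => by
      rw [add_mul, Complex.exp_add, norm_mul]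
      exact mul_le_mul (he2 s hs) (he2 s hs) (norm_nonneg _) hE0.le) (-Complex.I) (by simp)
  have hβ := key (Complex.I * lam + Complex.I * lam)
    (by rw [← two_mul, norm_mul, norm_mul]; simp)
    (fun s hs => by
      rw [add_mul, Complex.exp_add, norm_mul]
      exact mul_le_mul (he1 s hs) (he1 s hs) (norm_nonneg _) hE0.le) Complex.I (by simp)
  set U : ℝ → ℂ := fun s => Complex.exp (-(Complex.I * lam) * s) * (y s 0 + Complex.I * y s 1)
    with hU
  set V : ℝ → ℂ := fun s => Complex.exp (Complex.I * lam * s) * (y s 0 - Complex.I * y s 1)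
    with hV
  obtain ⟨hac, hd⟩ := isSolution_iff_ae.1 hy
  have hexpac : ∀ κ : ℂ,
      AbsolutelyContinuousOnInterval (fun s : ℝ => Complex.exp (κ * s)) 0 π := fun κ => by
    have h1 : ContDiff ℝ 1 fun s : ℝ => (s : ℂ) := Complex.ofRealCLM.contDiff
    have h2 : ContDiff ℝ 1 fun s : ℝ => Complex.exp (κ * s) := (contDiff_const.mul h1).cexp
    exact h2.contDiffOn.absolutelyContinuousOnInterval
  have hexpd : ∀ (κ : ℂ) (s : ℝ), HasDerivAt (fun s : ℝ => Complex.exp (κ * s))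
      (κ * Complex.exp (κ * s)) s := fun κ s => by
    have h1 : HasDerivAt (fun s : ℝ => κ * (s : ℂ)) (κ * 1) s :=
      (Complex.ofRealCLM.hasDerivAt (x := s)).const_mul κ
    exact h1.cexp.congr_deriv (by ring)
  have hUac : AbsolutelyContinuousOnInterval U 0 π :=
    (hexpac _).mul_complex ((hac.apply 0).add ((hac.apply 1).const_smul Complex.I))
  have hVac : AbsolutelyContinuousOnInterval V 0 π :=
    (hexpac _).mul_complex ((hac.apply 0).sub ((hac.apply 1).const_smul Complex.I))
  have hUd : ∀ᵐ s, s ∈ Icc 0 π → HasDerivAt U ((q s + -Complex.I * p s)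
      * Complex.exp ((-(Complex.I * lam) + -(Complex.I * lam)) * s) * V s) s := by
    filter_upwards [hd] with s h hs
    have h1 := hasDerivAt_pi.1 (h hs)
    refine HasDerivAt.congr_deriv
      ((hexpd _ s).mul ((h1 0).add ((h1 1).const_mul Complex.I))) ?_
    have h2 : Complex.exp ((-(Complex.I * lam) + -(Complex.I * lam)) * s)
        * Complex.exp (Complex.I * lam * s) = Complex.exp (-(Complex.I * lam) * s) := by
      rw [← Complex.exp_add]; congr 1; ring
    simp only [hV, coeff_apply, Matrix.cons_val_zero, Matrix.cons_val_one]
    rw [mul_assoc _ (Complex.exp _) (_ * _), ← mul_assoc (Complex.exp _) (Complex.exp _), h2]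
    linear_combination (-Complex.exp (-(Complex.I * lam) * s) *
      (lam * y s 1 + p s * y s 1)) * Complex.I_mul_I
  have hVd : ∀ᵐ s, s ∈ Icc 0 π → HasDerivAt V ((q s + Complex.I * p s)
      * Complex.exp ((Complex.I * lam + Complex.I * lam) * s) * U s) s := by
    filter_upwards [hd] with s h hs
    have h1 := hasDerivAt_pi.1 (h hs)
    refine HasDerivAt.congr_deriv
      ((hexpd _ s).mul ((h1 0).sub ((h1 1).const_mul Complex.I))) ?_
    have h2 : Complex.exp ((Complex.I * lam + Complex.I * lam) * s)
        * Complex.exp (-(Complex.I * lam) * s) = Complex.exp (Complex.I * lam * s) := by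
      rw [← Complex.exp_add]; congr 1; ring
    simp only [hU, coeff_apply, Matrix.cons_val_zero, Matrix.cons_val_one]
    rw [mul_assoc _ (Complex.exp _) (_ * _), ← mul_assoc (Complex.exp _) (Complex.exp _), h2]
    linear_combination (-Complex.exp (Complex.I * lam * s) *
      (lam * y s 1 + p s * y s 1)) * Complex.I_mul_I
  have hsmall : (Cq + Cp + 1) / ‖lam‖ * (1 + π * M) = K / ‖lam‖ := by rw [hK]; ring
  have hhalf : (Cq + Cp + 1) / ‖lam‖ * (1 + π * M) ≤ 1 / 2 := by
    rw [hsmall, div_le_div_iff₀ hl0 two_pos]; linarith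
  obtain ⟨h1, h2⟩ := norm_sub_le_of_coupled_system_of_small Real.pi_nonneg hUac hVac hUd hVd
    hα.1 hβ.1 hα.2.1 hβ.2.1 hα.2.2 hβ.2.2 hhalf hx
  rw [hsmall] at h1 h2
  have hU0 : U 0 = y 0 0 + Complex.I * y 0 1 := by simp [hU]
  have hV0 : V 0 = y 0 0 - Complex.I * y 0 1 := by simp [hV]
  have hb0 := norm_le_pi_norm (y 0) 0
  have hb1 := norm_le_pi_norm (y 0) 1
  have hmax : max ‖U 0‖ ‖V 0‖ ≤ 2 * ‖y 0‖ := by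
    rw [hU0, hV0]
    refine max_le ((norm_add_le _ _).trans ?_) ((norm_sub_le _ _).trans ?_) <;>
    · rw [norm_mul, Complex.norm_I, one_mul]; linarith
  have hfin : 2 * (K / ‖lam‖) * max ‖U 0‖ ‖V 0‖ ≤ 4 * (K / ‖lam‖) * ‖y 0‖ := by
    have h3 : 0 ≤ K / ‖lam‖ := by positivity
    nlinarith
  have hconst : 4 * E * K / ‖lam‖ * ‖y 0‖ = E * (4 * (K / ‖lam‖) * ‖y 0‖) := by ring
  have hinv : ∀ w : ℂ, Complex.exp w * Complex.exp (-w) = 1 := fun w => by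
    rw [← Complex.exp_add, add_neg_cancel, Complex.exp_zero]
  have hinv' := hinv (Complex.I * lam * x)
  rw [hconst]
  constructor
  · have h3 : y x 0 + Complex.I * y x 1
        - Complex.exp (Complex.I * lam * x) * (y 0 0 + Complex.I * y 0 1)
        = Complex.exp (Complex.I * lam * x) * (U x - U 0) := by
      rw [hU0, hU]
      simp only [neg_mul]
      linear_combination -(y x 0 + Complex.I * y x 1) * hinv'
    rw [h3, norm_mul]
    exact mul_le_mul (he1 x hx) (h1.trans hfin) (norm_nonneg _) hE0.le
  · have h3 : y x 0 - Complex.I * y x 1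
        - Complex.exp (-(Complex.I * lam) * x) * (y 0 0 - Complex.I * y 0 1)
        = Complex.exp (-(Complex.I * lam) * x) * (V x - V 0) := by
      rw [hV0, hV]
      simp only [neg_mul]
      linear_combination -(y x 0 - Complex.I * y x 1) * hinv'
    rw [h3, norm_mul]
    exact mul_le_mul (he2 x hx) (h2.trans hfin) (norm_nonneg _) hE0.le

end Dirac

/-! ### Perturbation bounds for complex exponential, sine and cosine -/

section Trigonometric

open Complex

theorem Complex.norm_cexp_I_mul_le (z : ℂ) : ‖cexp (I * z)‖ ≤ Real.exp |z.im| := by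
  rw [norm_exp]
  refine Real.exp_le_exp.2 ?_
  simpa using neg_le_abs z.im

theorem Complex.norm_cexp_neg_I_mul_le (z : ℂ) : ‖cexp (-(I * z))‖ ≤ Real.exp |z.im| := by
  rw [norm_exp]
  refine Real.exp_le_exp.2 ?_
  simpa using le_abs_self z.im

theorem Complex.cos_eq_cexp_I_mul (z : ℂ) : cos z = (cexp (I * z) + cexp (-(I * z))) / 2 := by
  rw [cos, mul_comm z I, neg_mul, mul_comm z I]

theorem Complex.sin_eq_cexp_I_mul (z : ℂ) :
    sin z = (cexp (-(I * z)) - cexp (I * z)) * I / 2 := by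
  rw [sin, mul_comm z I, neg_mul, mul_comm z I]

theorem Complex.norm_cos_le_exp (z : ℂ) : ‖cos z‖ ≤ Real.exp |z.im| := by
  rw [cos_eq_cexp_I_mul, norm_div, RCLike.norm_ofNat, div_le_iff₀ two_pos]
  linarith [norm_add_le (cexp (I * z)) (cexp (-(I * z))), norm_cexp_I_mul_le z,
    norm_cexp_neg_I_mul_le z]

theorem Complex.norm_sin_le_exp (z : ℂ) : ‖sin z‖ ≤ Real.exp |z.im| := by
  rw [sin_eq_cexp_I_mul, norm_div, norm_mul, norm_I, mul_one, RCLike.norm_ofNat,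
    div_le_iff₀ two_pos]
  linarith [norm_sub_le (cexp (-(I * z))) (cexp (I * z)), norm_cexp_I_mul_le z,
    norm_cexp_neg_I_mul_le z]

theorem Complex.norm_cexp_add_sub_le (a : ℂ) {w : ℂ} (hw : ‖w‖ ≤ 1) :
    ‖cexp (a + w) - cexp a‖ ≤ ‖cexp a‖ * (2 * ‖w‖) := by
  rw [exp_add, ← mul_sub_one, norm_mul]
  exact mul_le_mul_of_nonneg_left (norm_exp_sub_one_le hw) (norm_nonneg _)

theorem Complex.norm_cexp_add_sub_sub_le (a : ℂ) {w : ℂ} (hw : ‖w‖ ≤ 1) :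
    ‖cexp (a + w) - cexp a - cexp a * w‖ ≤ ‖cexp a‖ * ‖w‖ ^ 2 := by
  rw [exp_add, ← mul_sub_one, ← mul_sub, norm_mul]
  exact mul_le_mul_of_nonneg_left (norm_exp_sub_one_sub_id_le hw) (norm_nonneg _)

theorem Complex.norm_cexp_I_mul_add_sub_le (a : ℂ) {w : ℂ} (hw : ‖w‖ ≤ 1) :
    ‖cexp (I * (a + w)) - cexp (I * a)‖ ≤ Real.exp |a.im| * (2 * ‖w‖) := by
  have h1 := norm_cexp_add_sub_le (I * a) (w := I * w) (by simpa using hw)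
  rw [← mul_add, norm_mul I w, norm_I, one_mul] at h1
  exact h1.trans (mul_le_mul_of_nonneg_right (norm_cexp_I_mul_le a) (by positivity))

theorem Complex.norm_cexp_neg_I_mul_add_sub_le (a : ℂ) {w : ℂ} (hw : ‖w‖ ≤ 1) :
    ‖cexp (-(I * (a + w))) - cexp (-(I * a))‖ ≤ Real.exp |a.im| * (2 * ‖w‖) := by
  have h1 := norm_cexp_I_mul_add_sub_le (-a) (w := -w) (by simpa using hw)
  rwa [← neg_add, mul_neg, mul_neg, neg_im, abs_neg, norm_neg] at h1

theorem Complex.norm_cos_add_sub_le (a : ℂ) {w : ℂ} (hw : ‖w‖ ≤ 1) :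
    ‖cos (a + w) - cos a‖ ≤ Real.exp |a.im| * (2 * ‖w‖) := by
  have h1 : cos (a + w) - cos a = ((cexp (I * (a + w)) - cexp (I * a))
      + (cexp (-(I * (a + w))) - cexp (-(I * a)))) / 2 := by
    rw [cos_eq_cexp_I_mul, cos_eq_cexp_I_mul]; ring
  rw [h1, norm_div, RCLike.norm_ofNat, div_le_iff₀ two_pos]
  refine (norm_add_le _ _).trans ?_
  linarith [norm_cexp_I_mul_add_sub_le a hw, norm_cexp_neg_I_mul_add_sub_le a hw]

theorem Complex.norm_sin_add_sub_le (a : ℂ) {w : ℂ} (hw : ‖w‖ ≤ 1) :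
    ‖sin (a + w) - sin a‖ ≤ Real.exp |a.im| * (2 * ‖w‖) := by
  have h1 : sin (a + w) - sin a = ((cexp (-(I * (a + w))) - cexp (-(I * a)))
      - (cexp (I * (a + w)) - cexp (I * a))) * I / 2 := by
    rw [sin_eq_cexp_I_mul, sin_eq_cexp_I_mul]; ring
  rw [h1, norm_div, norm_mul, norm_I, mul_one, RCLike.norm_ofNat, div_le_iff₀ two_pos]
  refine (norm_sub_le _ _).trans ?_
  linarith [norm_cexp_I_mul_add_sub_le a hw, norm_cexp_neg_I_mul_add_sub_le a hw]

/-- The second-order remainder is needed for a lower bound on the variation of the cosine along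
small circles; the first-order bounds only give upper estimates. -/
theorem Complex.norm_cos_add_sub_add_le (a : ℂ) {w : ℂ} (hw : ‖w‖ ≤ 1) :
    ‖cos (a + w) - cos a + w * sin a‖ ≤ Real.exp |a.im| * ‖w‖ ^ 2 := by
  have h1 : cos (a + w) - cos a + w * sin a
      = ((cexp (I * a + I * w) - cexp (I * a) - cexp (I * a) * (I * w))
        + (cexp (-(I * a) + -(I * w)) - cexp (-(I * a)) - cexp (-(I * a)) * -(I * w))) / 2 := by
    rw [cos_eq_cexp_I_mul, cos_eq_cexp_I_mul, sin_eq_cexp_I_mul, ← mul_add, ← neg_add, ← mul_add]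
    ring
  have h2 := norm_cexp_add_sub_sub_le (I * a) (w := I * w) (by simpa using hw)
  have h3 := norm_cexp_add_sub_sub_le (-(I * a)) (w := -(I * w)) (by simpa using hw)
  rw [norm_mul I w, norm_I, one_mul] at h2
  rw [norm_neg, norm_mul I w, norm_I, one_mul] at h3
  have h4 := mul_le_mul_of_nonneg_right (norm_cexp_I_mul_le a) (sq_nonneg ‖w‖)
  have h5 := mul_le_mul_of_nonneg_right (norm_cexp_neg_I_mul_le a) (sq_nonneg ‖w‖)
  rw [h1, norm_div, RCLike.norm_ofNat, div_le_iff₀ two_pos]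
  refine (norm_add_le _ _).trans ?_
  linarith

end Trigonometric

/-! ### Large integers -/

/-- The filter of integers of large absolute value. -/
def largeInt : Filter ℤ := Filter.comap (fun n : ℤ => |(n : ℝ)|) Filter.atTop

theorem eventually_largeInt_iff {P : ℤ → Prop} :
    (∀ᶠ n in largeInt, P n) ↔ ∃ N : ℕ, ∀ n : ℤ, (N : ℤ) < |n| → P n := by
  rw [largeInt, Filter.eventually_comap]
  constructor
  · intro h
    obtain ⟨a, ha⟩ := Filter.eventually_atTop.1 h
    obtain ⟨N, hN⟩ := exists_nat_gt a
    refine ⟨N, fun n hn => ha _ ?_ n rfl⟩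
    have : ((N : ℤ) : ℝ) < ((|n| : ℤ) : ℝ) := Int.cast_lt.2 hn
    push_cast at this
    linarith
  · rintro ⟨N, hN⟩
    refine Filter.eventually_atTop.2 ⟨N + 1, fun a ha n hn => hN n ?_⟩
    have : ((N : ℤ) : ℝ) < ((|n| : ℤ) : ℝ) := by push_cast; linarith
    exact Int.cast_lt.1 this

theorem eventually_largeInt_div_le (C : ℝ) {ε : ℝ} (hε : 0 < ε) :
    ∀ᶠ n : ℤ in largeInt, C / |(n : ℝ)| ≤ ε :=
  ((Filter.tendsto_comap (f := fun n : ℤ => |(n : ℝ)|)).const_div_atTop C).eventually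
    (eventually_le_nhds hε)

theorem eventually_largeInt_le (C : ℝ) : ∀ᶠ n : ℤ in largeInt, C ≤ |(n : ℝ)| :=
  (Filter.tendsto_comap (f := fun n : ℤ => |(n : ℝ)|)).eventually (Filter.eventually_ge_atTop C)

/-! ### Monodromy matrix, characteristic equation and the geometry of `D h` -/

namespace Dirac

variable {p q : ℝ → ℂ} {lam t σ : ℂ} {h : ℝ}

/-- For large `lam` in a horizontal strip, every solution is close to the solution of the free
equation with the same initial value. -/
theorem exists_solution_close_to_free (hp : BoundedVariationOn p (Icc 0 π))
    (hq : BoundedVariationOn q (Icc 0 π)) (R : ℝ) :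
    ∃ K Λ : ℝ, 0 < K ∧ 0 < Λ ∧ ∀ lam : ℂ, |lam.im| ≤ R → Λ ≤ ‖lam‖ →
      ∀ y, IsSolution p q lam y → ∀ x ∈ Icc 0 π,
        ‖y x 0 - (Complex.cos (lam * x) * y 0 0 - Complex.sin (lam * x) * y 0 1)‖
          ≤ K / ‖lam‖ * ‖y 0‖ ∧
        ‖y x 1 - (Complex.sin (lam * x) * y 0 0 + Complex.cos (lam * x) * y 0 1)‖
          ≤ K / ‖lam‖ * ‖y 0‖ := by
  obtain ⟨K, Λ, hK, hΛ, H⟩ := exists_solution_asymptotics hp hq R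
  refine ⟨K, Λ, hK, hΛ, fun lam hlam hl y hy x hx => ?_⟩
  obtain ⟨h1, h2⟩ := H lam hlam hl y hy x hx
  have e1 : Complex.I * lam * x = Complex.I * (lam * x) := by ring
  have e2 : -(Complex.I * lam) * x = -(Complex.I * (lam * x)) := by ring
  rw [e1] at h1
  rw [e2] at h2
  rw [Complex.cos_eq_cexp_I_mul, Complex.sin_eq_cexp_I_mul]
  set a := Complex.exp (Complex.I * (lam * x))
  set b := Complex.exp (-(Complex.I * (lam * x)))
  -- `X` and `Y` are the errors in `y₁ ± i y₂`; half their sum and half their difference (times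
  -- `-i`) are the errors in the two components.
  set X := y x 0 + Complex.I * y x 1 - a * (y 0 0 + Complex.I * y 0 1) with hX
  set Y := y x 0 - Complex.I * y x 1 - b * (y 0 0 - Complex.I * y 0 1) with hY
  constructor
  · have h3 : y x 0 - ((a + b) / 2 * y 0 0 - (b - a) * Complex.I / 2 * y 0 1) = (X + Y) / 2 := by
      rw [hX, hY]; ring
    rw [h3, norm_div, RCLike.norm_ofNat, div_le_iff₀ two_pos]
    linarith [norm_add_le X Y]
  · have h3 : y x 1 - ((b - a) * Complex.I / 2 * y 0 0 + (a + b) / 2 * y 0 1)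
        = -Complex.I * (X - Y) / 2 := by
      rw [hX, hY]
      linear_combination (y x 1 - (a + b) / 2 * y 0 1) * Complex.I_mul_I
    rw [h3, norm_div, norm_mul, norm_neg, Complex.norm_I, one_mul, RCLike.norm_ofNat,
      div_le_iff₀ two_pos]
    linarith [norm_sub_le X Y]

theorem pi_mem_Icc : π ∈ Icc 0 π := right_mem_Icc.2 Real.pi_nonneg

/-- The entries of the monodromy matrix are close to those for the free equation. -/
theorem exists_monodromy_asymptotics (hp : BoundedVariationOn p (Icc 0 π))
    (hq : BoundedVariationOn q (Icc 0 π)) (R : ℝ) :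
    ∃ K Λ : ℝ, 0 < K ∧ 0 < Λ ∧ ∀ lam : ℂ, |lam.im| ≤ R → Λ ≤ ‖lam‖ →
      ‖c p q lam π 0 - Complex.cos (π * lam)‖ ≤ K / ‖lam‖ ∧
      ‖s p q lam π 0 + Complex.sin (π * lam)‖ ≤ K / ‖lam‖ ∧
      ‖F p q lam - 2 * Complex.cos (π * lam)‖ ≤ K / ‖lam‖ := by
  obtain ⟨K, Λ, hK, hΛ, H⟩ := exists_solution_close_to_free hp hq R
  refine ⟨2 * K, Λ, by positivity, hΛ, fun lam hlam hl => ?_⟩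
  obtain ⟨hc, hc0⟩ := isSolution_solution hp hq lam ![1, 0]
  obtain ⟨hs, hs0⟩ := isSolution_solution hp hq lam ![0, 1]
  have n1 : ‖(![1, 0] : Fin 2 → ℂ)‖ ≤ 1 := by
    rw [pi_norm_le_iff_of_nonneg zero_le_one]; intro i; fin_cases i <;> simp
  have n2 : ‖(![0, 1] : Fin 2 → ℂ)‖ ≤ 1 := by
    rw [pi_norm_le_iff_of_nonneg zero_le_one]; intro i; fin_cases i <;> simp
  have hKl : 0 ≤ K / ‖lam‖ := by positivity
  have h1 := (H lam hlam hl _ hc π pi_mem_Icc).1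
  have h2 := (H lam hlam hl _ hs π pi_mem_Icc).1
  have h3 := (H lam hlam hl _ hs π pi_mem_Icc).2
  rw [hc0] at h1
  rw [hs0] at h2 h3
  simp only [Matrix.cons_val_zero, Matrix.cons_val_one, mul_one, mul_zero, sub_zero, zero_sub,
    zero_add, sub_neg_eq_add, mul_comm lam] at h1 h2 h3
  replace h1 := h1.trans (mul_le_of_le_one_right hKl n1)
  replace h2 := h2.trans (mul_le_of_le_one_right hKl n2)
  replace h3 := h3.trans (mul_le_of_le_one_right hKl n2)
  have h4 : 2 * K / ‖lam‖ = K / ‖lam‖ + K / ‖lam‖ := by ring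
  rw [h4]
  refine ⟨h1.trans (by linarith), h2.trans (by linarith), ?_⟩
  have h5 : F p q lam - 2 * Complex.cos (π * lam)
      = (solution p q lam ![1, 0] π 0 - Complex.cos (π * lam))
        + (solution p q lam ![0, 1] π 1 - Complex.cos (π * lam)) := by
    rw [F, c, s]; ring
  rw [h5]
  exact (norm_add_le _ _).trans (add_le_add h1 h3)

theorem differentiable_F (hp : BoundedVariationOn p (Icc 0 π))
    (hq : BoundedVariationOn q (Icc 0 π)) : Differentiable ℂ (F p q) :=
  (differentiable_solution hp hq ![1, 0] pi_mem_Icc 0).add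
    (differentiable_solution hp hq ![0, 1] pi_mem_Icc 1)

theorem c_mul_s_sub (hp : BoundedVariationOn p (Icc 0 π)) (hq : BoundedVariationOn q (Icc 0 π))
    (lam : ℂ) : c p q lam π 0 * s p q lam π 1 - c p q lam π 1 * s p q lam π 0 = 1 := by
  obtain ⟨hc, hc0⟩ := isSolution_solution hp hq lam ![1, 0]
  obtain ⟨hs, hs0⟩ := isSolution_solution hp hq lam ![0, 1]
  have := hc.wronskian_eq hs pi_mem_Icc
  rw [hc0, hs0] at this
  exact this.trans (by simp)

/-- Every solution is a combination of the two fundamental ones. -/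
theorem IsSolution.eq_combination (hp : BoundedVariationOn p (Icc 0 π))
    (hq : BoundedVariationOn q (Icc 0 π)) {y : ℝ → Fin 2 → ℂ} (hy : IsSolution p q lam y) :
    EqOn y (fun x => y 0 0 • c p q lam x + y 0 1 • s p q lam x) (Icc 0 π) := by
  obtain ⟨hc, hc0⟩ := isSolution_solution hp hq lam ![1, 0]
  obtain ⟨hs, hs0⟩ := isSolution_solution hp hq lam ![0, 1]
  refine hy.eqOn hp hq ((hc.const_smul (y 0 0)).add (hs.const_smul (y 0 1))) ?_
  have h1 : c p q lam 0 = ![1, 0] := hc0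
  have h2 : s p q lam 0 = ![0, 1] := hs0
  simp only [h1, h2]
  ext i
  fin_cases i <;> simp

/-- An eigenvalue is a zero of the characteristic polynomial of the monodromy matrix. -/
theorem IsEigenvalue.characteristic_eq (hp : BoundedVariationOn p (Icc 0 π))
    (hq : BoundedVariationOn q (Icc 0 π)) (hl : IsEigenvalue p q t lam) :
    Complex.exp (Complex.I * π * t) ^ 2 - Complex.exp (Complex.I * π * t) * F p q lam + 1 = 0 := by
  obtain ⟨y, hy, hbc, x, hx, hne⟩ := hl
  have hcomb := hy.eq_combination hp hq
  have hπ := hcomb pi_mem_Icc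
  rw [hbc] at hπ
  have e0 := congrFun hπ 0
  have e1 := congrFun hπ 1
  simp only [Pi.smul_apply, Pi.add_apply, smul_eq_mul] at e0 e1
  have hdet := c_mul_s_sub hp hq lam
  rw [F]
  set e := Complex.exp (Complex.I * π * t)
  -- `y 0` is a nonzero null vector of the monodromy matrix minus `e`. Eliminating the other
  -- component by Cramer's rule leaves the determinant times a nonzero component, with monodromy
  -- determinant 1 and trace `F`.
  by_cases h0 : y 0 0 = 0
  · have h1 : y 0 1 ≠ 0 := by
      intro h1
      exact hne (by rw [hcomb hx]; simp [h0, h1])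
    refine mul_left_cancel₀ h1 ?_
    linear_combination (-y 0 1) * hdet + (e - c p q lam π 0) * e1 + c p q lam π 1 * e0
  · refine mul_left_cancel₀ h0 ?_
    linear_combination (-y 0 0) * hdet + (e - s p q lam π 1) * e0 + s p q lam π 0 * e1

/-- The coefficients of `Phi` make the first component of the boundary condition automatic; the
second is the characteristic equation combined with determinant 1. The first component of `Phi` at 0
is `s₁(π) ≠ 0`. -/
theorem isEigenfunction_Phi (hp : BoundedVariationOn p (Icc 0 π))
    (hq : BoundedVariationOn q (Icc 0 π)) (hs0 : s p q lam π 0 ≠ 0)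
    (hl : Complex.exp (Complex.I * π * t) ^ 2 - Complex.exp (Complex.I * π * t) * F p q lam + 1
      = 0) : IsEigenfunction p q t lam (Phi p q t lam) := by
  obtain ⟨hc, hc0⟩ := isSolution_solution hp hq lam ![1, 0]
  obtain ⟨hs, hs0'⟩ := isSolution_solution hp hq lam ![0, 1]
  have hdet := c_mul_s_sub hp hq lam
  have hΦ0 : Phi p q t lam 0
      = ![s p q lam π 0, Complex.exp (Complex.I * π * t) - c p q lam π 0] := by
    rw [Phi]
    have h1 : c p q lam 0 = ![1, 0] := hc0
    have h2 : s p q lam 0 = ![0, 1] := hs0'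
    rw [h1, h2]
    ext i
    fin_cases i <;> simp
  refine ⟨(hc.const_smul _).add (hs.const_smul _), ?_, 0, left_mem_Icc.2 Real.pi_nonneg, ?_⟩
  · rw [hΦ0, Phi]
    rw [F] at hl
    ext i
    fin_cases i
    · simp
      ring
    · simp
      linear_combination -hl - hdet
  · intro h0
    rw [hΦ0] at h0
    exact hs0 (congrFun h0 0)

theorem norm_eq_one_of_sign (hσ : σ = 1 ∨ σ = -1) : ‖σ‖ = 1 := by
  rcases hσ with rfl | rfl <;> simp

theorem mul_self_of_sign (hσ : σ = 1 ∨ σ = -1) : σ * σ = 1 := by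
  rcases hσ with rfl | rfl <;> simp

theorem cos_pi_mul (hσ : σ = 1 ∨ σ = -1) (n : ℤ) (t : ℂ) :
    Complex.cos (π * (2 * n + σ * t)) = Complex.cos (π * t) := by
  have h1 : (π : ℂ) * (2 * n + σ * t) = σ * (π * t) + n * (2 * π) := by ring
  rw [h1, Complex.cos_add_int_mul_two_pi]
  rcases hσ with rfl | rfl <;> simp

theorem sin_pi_mul (hσ : σ = 1 ∨ σ = -1) (n : ℤ) (t : ℂ) :
    Complex.sin (π * (2 * n + σ * t)) = σ * Complex.sin (π * t) := by
  have h1 : (π : ℂ) * (2 * n + σ * t) = σ * (π * t) + n * (2 * π) := by ring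
  rw [h1, Complex.sin_add_int_mul_two_pi]
  rcases hσ with rfl | rfl <;> simp

/-- Removing open discs keeps `D h` compact, so the minimum is attained. A zero would be an integer;
the real-part bounds leave only 0 and 1, both centres of removed discs. -/
theorem exists_le_norm_sin_of_mem_D (h_pos : 0 < h) (h_lt : h < 1 / 10) :
    ∃ κ, 0 < κ ∧ ∀ t ∈ D h, κ ≤ ‖Complex.sin (π * t)‖ := by
  have hcomp : IsCompact (D h) := by
    refine Metric.isCompact_of_isClosed_isBounded ?_ ?_
    · refine IsClosed.sdiff ?_ (Metric.isOpen_ball.union Metric.isOpen_ball)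
      exact (isClosed_le Complex.continuous_im.abs continuous_const).inter
        ((isClosed_le continuous_const Complex.continuous_re).inter
          (isClosed_le Complex.continuous_re continuous_const))
    · refine (Metric.isBounded_iff_subset_closedBall 0).2 ⟨4, fun t ht => ?_⟩
      rw [mem_closedBall_zero_iff]
      obtain ⟨⟨h1, h2, h3⟩, -⟩ := ht
      refine (Complex.norm_le_abs_re_add_abs_im t).trans ?_
      have : |t.re| ≤ 2 := abs_le.2 ⟨by linarith, by linarith⟩
      linarith
  have hne : (D h).Nonempty := by
    refine ⟨(1 / 2 : ℝ), ⟨⟨?_, ?_, ?_⟩, ?_⟩⟩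
    · rw [Complex.ofReal_im, abs_zero]; linarith
    · rw [Complex.ofReal_re]; linarith
    · rw [Complex.ofReal_re]; linarith
    · rintro (h1 | h1) <;> rw [Metric.mem_ball, dist_eq_norm] at h1
      · rw [sub_zero, Complex.norm_real] at h1
        norm_num at h1; linarith
      · rw [← Complex.ofReal_one, ← Complex.ofReal_sub, Complex.norm_real] at h1
        norm_num at h1; linarith
  have hcont : Continuous fun t : ℂ => ‖Complex.sin (π * t)‖ := by fun_prop
  obtain ⟨t₀, ht₀, hmin⟩ := hcomp.exists_isMinOn hne hcont.continuousOn
  refine ⟨_, norm_pos_iff.2 ?_, fun t ht => hmin ht⟩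
  intro h0
  obtain ⟨k, hk⟩ := Complex.sin_eq_zero_iff.1 h0
  have hk' : t₀ = (k : ℂ) := by
    have : (π : ℂ) ≠ 0 := Complex.ofReal_ne_zero.2 Real.pi_ne_zero
    refine mul_left_cancel₀ this ?_
    rw [hk]; ring
  obtain ⟨⟨-, h2, h3⟩, h4⟩ := ht₀
  rw [hk', Complex.intCast_re] at h2 h3
  have h5 : -1 < k := by
    have : (-1 : ℝ) < k := by linarith
    exact_mod_cast this
  have h6 : k < 2 := by
    have : (k : ℝ) < 2 := by linarith
    exact_mod_cast this
  have h7 : k = 0 ∨ k = 1 := by omega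
  refine h4 ?_
  rcases h7 with rfl | rfl
  · left; rw [hk']; simpa using h_pos
  · right; rw [hk']; simpa using h_pos

/-- Places all points in use inside the strip `|im| ≤ 3`, where the asymptotics apply with `R = 3`,
and turns `O(1/‖z‖)` into `O(1/|n|)`. The radius 2 leaves room for a unit circle around a point near
`2n + σt`; since `‖σt‖ ≤ 3`, one has `‖z‖ ≥ 2|n| - 5`. -/
theorem im_and_norm_bounds (h_pos : 0 < h) (h_lt : h < 1 / 10) (hσ : σ = 1 ∨ σ = -1) {n : ℤ}
    (hn : 6 ≤ |(n : ℝ)|) (ht : t ∈ D h) {z : ℂ} (hz : ‖z - (2 * n + σ * t)‖ ≤ 2) :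
    |z.im| ≤ 3 ∧ |(n : ℝ)| ≤ ‖z‖ := by
  obtain ⟨⟨h1, h2, h3⟩, -⟩ := ht
  have ht3 : ‖t‖ ≤ 3 := by
    refine (Complex.norm_le_abs_re_add_abs_im t).trans ?_
    have : |t.re| ≤ 2 := abs_le.2 ⟨by linarith, by linarith⟩
    linarith
  have hσt : ‖σ * t‖ ≤ 3 := by rwa [norm_mul, norm_eq_one_of_sign hσ, one_mul]
  constructor
  · have h4 : |(z - (2 * n + σ * t)).im| ≤ 2 := (Complex.abs_im_le_norm _).trans hz
    have h5 : |(σ * t).im| ≤ 1 / 2 := by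
      rcases hσ with rfl | rfl
      · rw [one_mul]; linarith
      · rw [neg_one_mul, Complex.neg_im, abs_neg]; linarith
    have h6 : z.im = (z - (2 * n + σ * t)).im + (σ * t).im := by simp
    rw [h6]
    exact (abs_add_le _ _).trans (by linarith)
  · have h4 : ‖(2 * n : ℂ)‖ = 2 * |(n : ℝ)| := by
      rw [norm_mul, RCLike.norm_ofNat, Complex.norm_intCast]
    have h5 : (2 * n : ℂ) = z - (z - (2 * n + σ * t)) - σ * t := by ring
    rw [h5] at h4
    have h6 := norm_sub_le (z - (z - (2 * n + σ * t))) (σ * t)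
    have h7 := norm_sub_le z (z - (2 * n + σ * t))
    linarith

end Dirac

/-! ### Location of eigenvalues and asymptotics of eigenfunctions -/

namespace Dirac

variable {p q : ℝ → ℂ} {lam t σ : ℂ} {h : ℝ}

theorem exp_pi_im_le {z : ℂ} (hz : |z.im| ≤ 3) :
    Real.exp |((π : ℂ) * z).im| ≤ Real.exp (π * 3) := by
  rw [Complex.im_ofReal_mul, abs_mul, abs_of_pos Real.pi_pos]
  exact Real.exp_le_exp.2 (mul_le_mul_of_nonneg_left hz Real.pi_nonneg)

theorem norm_pi_mul (w : ℂ) : ‖(π : ℂ) * w‖ = π * ‖w‖ := by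
  rw [norm_mul, Complex.norm_real, Real.norm_of_nonneg Real.pi_nonneg]

theorem norm_cos_pi_mul_sub_le (h_pos : 0 < h) (h_lt : h < 1 / 10) (hσ : σ = 1 ∨ σ = -1) {n : ℤ}
    (hn : 6 ≤ |(n : ℝ)|) (ht : t ∈ D h) {z : ℂ} (hz : π * ‖z - (2 * n + σ * t)‖ ≤ 1) :
    ‖Complex.cos (π * z) - Complex.cos (π * t)‖
      ≤ Real.exp (π * 3) * (2 * (π * ‖z - (2 * n + σ * t)‖)) := by
  have h0 := (im_and_norm_bounds h_pos h_lt hσ hn ht (z := 2 * n + σ * t) (by simp)).1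
  have h1 := Complex.norm_cos_add_sub_le (π * (2 * n + σ * t))
    (w := π * (z - (2 * n + σ * t))) (by rwa [norm_pi_mul])
  rw [← mul_add, add_sub_cancel, cos_pi_mul hσ, norm_pi_mul] at h1
  exact h1.trans (mul_le_mul_of_nonneg_right (exp_pi_im_le h0)
    (by have := Real.pi_pos; positivity))

theorem norm_sin_pi_mul_sub_le (h_pos : 0 < h) (h_lt : h < 1 / 10) (hσ : σ = 1 ∨ σ = -1) {n : ℤ}
    (hn : 6 ≤ |(n : ℝ)|) (ht : t ∈ D h) {z : ℂ} (hz : π * ‖z - (2 * n + σ * t)‖ ≤ 1) :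
    ‖Complex.sin (π * z) - σ * Complex.sin (π * t)‖
      ≤ Real.exp (π * 3) * (2 * (π * ‖z - (2 * n + σ * t)‖)) := by
  have h0 := (im_and_norm_bounds h_pos h_lt hσ hn ht (z := 2 * n + σ * t) (by simp)).1
  have h1 := Complex.norm_sin_add_sub_le (π * (2 * n + σ * t))
    (w := π * (z - (2 * n + σ * t))) (by rwa [norm_pi_mul])
  rw [← mul_add, add_sub_cancel, sin_pi_mul hσ, norm_pi_mul] at h1
  exact h1.trans (mul_le_mul_of_nonneg_right (exp_pi_im_le h0)
    (by have := Real.pi_pos; positivity))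

/-- `F'` does not vanish near the points `2n + σt`. -/
theorem exists_deriv_F_ne_zero (hp : BoundedVariationOn p (Icc 0 π))
    (hq : BoundedVariationOn q (Icc 0 π)) (h_pos : 0 < h) (h_lt : h < 1 / 10)
    (hσ : σ = 1 ∨ σ = -1) :
    ∃ r, 0 < r ∧ ∀ᶠ n : ℤ in largeInt, ∀ t ∈ D h, ∀ z : ℂ, ‖z - (2 * n + σ * t)‖ ≤ r →
      deriv (F p q) z ≠ 0 := by
  obtain ⟨κ, hκ, hsin⟩ := exists_le_norm_sin_of_mem_D h_pos h_lt
  obtain ⟨K, Λ, hK, hΛ, hF⟩ := exists_monodromy_asymptotics hp hq 3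
  have hπ := Real.pi_pos
  set E := Real.exp (π * 3) with hE
  have hE0 : 0 < E := Real.exp_pos _
  -- With `π ≤ 4`, the bound `1/4` gives `π * w ≤ 1`; the second bound lets `sin(πz)` move by at
  -- most `κ/2`.
  refine ⟨min (1 / 4) (κ / (4 * E * π)), by positivity, ?_⟩
  filter_upwards [eventually_largeInt_le 6, eventually_largeInt_le Λ,
    eventually_largeInt_div_le K (show 0 < π * κ / 2 by positivity)] with n hn6 hnΛ hnK t ht z hz
  have hn0 : 0 < |(n : ℝ)| := by linarith
  have hz1 := hz.trans (min_le_left _ _)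
  have hz2 := hz.trans (min_le_right _ _)
  set w := ‖z - (2 * n + σ * t)‖ with hw
  have hπw : π * w ≤ 1 := by nlinarith [Real.pi_le_four, norm_nonneg (z - (2 * n + σ * t))]
  have hEw : E * (2 * (π * w)) ≤ κ / 2 := by
    rw [le_div_iff₀ (by positivity)] at hz2
    linarith
  have h1 := (norm_sin_pi_mul_sub_le h_pos h_lt hσ hn6 ht hπw).trans hEw
  have h2 : κ ≤ ‖σ * Complex.sin (π * t)‖ := by
    rw [norm_mul, norm_eq_one_of_sign hσ, one_mul]; exact hsin t ht
  have h3 : κ / 2 ≤ ‖Complex.sin (π * z)‖ := by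
    have := norm_sub_norm_le (σ * Complex.sin (π * t)) (Complex.sin (π * z))
    rw [norm_sub_rev] at this
    linarith
  have hdcos : ∀ z : ℂ, HasDerivAt (fun z : ℂ => 2 * Complex.cos (π * z))
      (2 * (-Complex.sin (π * z) * π)) z := fun z => by
    have h4 : HasDerivAt (fun z : ℂ => (π : ℂ) * z) π z := by
      simpa using (hasDerivAt_id z).const_mul (π : ℂ)
    exact (h4.ccos).const_mul 2
  have hdF := differentiable_F hp hq
  have hdG : Differentiable ℂ fun z => F p q z - 2 * Complex.cos (π * z) :=
    hdF.sub fun z => (hdcos z).differentiableAt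
  -- Cauchy's estimate on the unit circle turns smallness of `F - 2 cos πz` into smallness of its
  -- derivative; `F' z = 0` would then force `2π|sin πz|` below `πκ/2`, while it is at least `πκ`.
  have hcauchy : ‖deriv (fun z => F p q z - 2 * Complex.cos (π * z)) z‖ ≤ K / |(n : ℝ)| / 1 := by
    refine Complex.norm_deriv_le_of_forall_mem_sphere_norm_le one_pos hdG.diffContOnCl
      fun u hu => ?_
    have hu' : ‖u - (2 * n + σ * t)‖ ≤ 2 := by
      rw [mem_sphere_iff_norm] at hu
      have h5 : u - (2 * n + σ * t) = (u - z) + (z - (2 * n + σ * t)) := by ring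
      rw [h5]
      exact (norm_add_le _ _).trans (by rw [hu]; linarith)
    obtain ⟨h6, h7⟩ := im_and_norm_bounds h_pos h_lt hσ hn6 ht hu'
    refine (hF u h6 (hnΛ.trans h7)).2.2.trans ?_
    gcongr
  intro h0
  have h8 : HasDerivAt (fun z => F p q z - 2 * Complex.cos (π * z))
      (0 - 2 * (-Complex.sin (π * z) * π)) z := by
    have h9 := (hdF z).hasDerivAt
    rw [h0] at h9
    exact h9.sub (hdcos z)
  rw [h8.deriv, div_one] at hcauchy
  have h10 : ‖(0 : ℂ) - 2 * (-Complex.sin (π * z) * π)‖ = 2 * (π * ‖Complex.sin (π * z)‖) := by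
    rw [zero_sub, norm_neg, norm_mul, norm_mul, norm_neg, RCLike.norm_ofNat, Complex.norm_real,
      Real.norm_of_nonneg hπ.le]
    ring
  rw [h10] at hcauchy
  have h11 : π * (κ / 2) ≤ π * ‖Complex.sin (π * z)‖ := mul_le_mul_of_nonneg_left h3 hπ.le
  have h12 : 0 < π * κ := by positivity
  linarith

/-- The equation `F(z) = 2 cos(πt)` has a solution close to `2n + σt`. -/
theorem exists_F_eq (hp : BoundedVariationOn p (Icc 0 π))
    (hq : BoundedVariationOn q (Icc 0 π)) (h_pos : 0 < h) (h_lt : h < 1 / 10)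
    (hσ : σ = 1 ∨ σ = -1) :
    ∃ C : ℝ, ∀ᶠ n : ℤ in largeInt, ∀ t ∈ D h, ∃ z : ℂ,
      F p q z = 2 * Complex.cos (π * t) ∧ ‖z - (2 * n + σ * t)‖ ≤ C / |(n : ℝ)| := by
  obtain ⟨κ, hκ, hsin⟩ := exists_le_norm_sin_of_mem_D h_pos h_lt
  obtain ⟨K, Λ, hK, hΛ, hF⟩ := exists_monodromy_asymptotics hp hq 3
  obtain ⟨r, hr, hderiv⟩ := exists_deriv_F_ne_zero hp hq h_pos h_lt hσ
  have hπ := Real.pi_pos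
  set E := Real.exp (π * 3) with hE
  have hE0 : 0 < E := Real.exp_pos _
  -- On the circle of radius `C/|n|`, `2 cos πz` moves by at least `(4K + 4)/|n|`. Two errors
  -- `K/|n|` leave `(2K + 4)/|n|` for `F`, and half of this exceeds the distance `K/|n|` from `F z₀`
  -- to the target.
  set C := (4 * K + 4) / (π * κ) with hC
  have hC0 : 0 < C := by positivity
  refine ⟨C, ?_⟩
  filter_upwards [eventually_largeInt_le 6, eventually_largeInt_le Λ, hderiv,
    eventually_largeInt_div_le C (show (0 : ℝ) < 1 / 4 by norm_num),
    eventually_largeInt_div_le C (show 0 < κ / (2 * E * π) by positivity)]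
    with n hn6 hnΛ hder hn1 hn2 t ht
  have hn0 : 0 < |(n : ℝ)| := by linarith
  set z₀ : ℂ := 2 * n + σ * t with hz₀
  set ρ := C / |(n : ℝ)| with hρ
  have hρ0 : 0 < ρ := by positivity
  have hπρ : π * ρ ≤ 1 := by nlinarith [Real.pi_le_four]
  have hρκ : π * κ * ρ = (4 * K + 4) / |(n : ℝ)| := by
    rw [hρ, hC]; field_simp
  obtain ⟨him0, hnorm0⟩ := im_and_norm_bounds h_pos h_lt hσ hn6 ht (z := z₀) (by simp [hz₀])
  have hF0 : ‖F p q z₀ - 2 * Complex.cos (π * t)‖ ≤ K / |(n : ℝ)| := by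
    rw [← cos_pi_mul hσ n t]
    refine (hF z₀ him0 (hnΛ.trans hnorm0)).2.2.trans ?_
    gcongr
  have hsin0 : κ ≤ ‖Complex.sin (π * z₀)‖ := by
    rw [sin_pi_mul hσ, norm_mul, norm_eq_one_of_sign hσ, one_mul]; exact hsin t ht
  have hsphere : ∀ z ∈ Metric.sphere z₀ ρ, (2 * K + 4) / |(n : ℝ)| ≤ ‖F p q z - F p q z₀‖ := by
    intro z hz
    rw [mem_sphere_iff_norm] at hz
    obtain ⟨him, hnorm⟩ := im_and_norm_bounds h_pos h_lt hσ hn6 ht (z := z)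
      (by rw [← hz₀, hz]; linarith)
    have hFz : ‖F p q z - 2 * Complex.cos (π * z)‖ ≤ K / |(n : ℝ)| := by
      refine (hF z him (hnΛ.trans hnorm)).2.2.trans ?_
      gcongr
    have h1 := Complex.norm_cos_add_sub_add_le (π * z₀) (w := π * (z - z₀))
      (by rw [norm_pi_mul, hz]; exact hπρ)
    rw [← mul_add, add_sub_cancel, norm_pi_mul, hz] at h1
    have h2 : ‖π * (z - z₀) * Complex.sin (π * z₀)‖ ≥ π * ρ * κ := by
      rw [norm_mul, norm_pi_mul, hz]
      gcongr
    have h3 : Real.exp |((π : ℂ) * z₀).im| * (π * ρ) ^ 2 ≤ π * ρ * (κ / 2) := by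
      have h4 : E * (π * ρ) ≤ κ / 2 := by
        rw [le_div_iff₀ (by positivity)] at hn2
        linarith
      calc _ ≤ E * (π * ρ) ^ 2 := mul_le_mul_of_nonneg_right (exp_pi_im_le him0) (sq_nonneg _)
        _ = π * ρ * (E * (π * ρ)) := by ring
        _ ≤ _ := mul_le_mul_of_nonneg_left h4 (by positivity)
    have h5 : π * ρ * (κ / 2) ≤ ‖Complex.cos (π * z) - Complex.cos (π * z₀)‖ := by
      have h6 := norm_add_le (Complex.cos (π * z) - Complex.cos (π * z₀)
          + π * (z - z₀) * Complex.sin (π * z₀))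
        (-(Complex.cos (π * z) - Complex.cos (π * z₀)))
      rw [norm_neg, add_neg_cancel_comm] at h6
      linarith
    have h7 : F p q z - F p q z₀ = 2 * (Complex.cos (π * z) - Complex.cos (π * z₀))
        - ((F p q z₀ - 2 * Complex.cos (π * t)) - (F p q z - 2 * Complex.cos (π * z))) := by
      rw [hz₀, cos_pi_mul hσ]; ring
    rw [h7]
    refine le_trans ?_ (norm_sub_norm_le _ _)
    rw [norm_mul, RCLike.norm_ofNat]
    have h8 := norm_sub_le (F p q z₀ - 2 * Complex.cos (π * t))
      (F p q z - 2 * Complex.cos (π * z))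
    have h9 : (2 * K + 4) / |(n : ℝ)| = (4 * K + 4) / |(n : ℝ)| - 2 * (K / |(n : ℝ)|) := by ring
    rw [h9, ← hρκ]
    linarith
  have hfreq : ∃ᶠ z in nhds z₀, F p q z ≠ F p q z₀ := by
    have h1 := hder t ht z₀ (by simp [hz₀, hr.le])
    have h2 : HasDerivAt (F p q) (deriv (F p q) z₀) z₀ := (differentiable_F hp hq z₀).hasDerivAt
    exact (h2.eventually_ne h1).frequently.filter_mono nhdsWithin_le_nhds
  -- Open mapping: the image of the closed disc contains the ball around `F z₀` of half the minimal
  -- displacement on the circle.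
  have himg := (differentiable_F hp hq).diffContOnCl.ball_subset_image_closedBall hρ0 hsphere hfreq
  obtain ⟨z, hz, hFz⟩ := himg (a := 2 * Complex.cos (π * t)) (by
    rw [mem_ball_iff_norm, norm_sub_rev]
    refine lt_of_le_of_lt hF0 ?_
    rw [div_div, mul_comm _ (2 : ℝ), ← div_div]
    gcongr
    linarith)
  exact ⟨z, hFz, by rwa [mem_closedBall_iff_norm] at hz⟩

/-- Closeness of the entries of the monodromy matrix at points `2n + σt + O(1/n)`. -/
theorem exists_monodromy_close (hp : BoundedVariationOn p (Icc 0 π))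
    (hq : BoundedVariationOn q (Icc 0 π)) (h_pos : 0 < h) (h_lt : h < 1 / 10)
    (hσ : σ = 1 ∨ σ = -1) (C : ℝ) :
    ∃ B : ℝ, 0 < B ∧ ∀ᶠ n : ℤ in largeInt, ∀ t ∈ D h, ∀ z : ℂ,
      ‖z - (2 * n + σ * t)‖ ≤ C / |(n : ℝ)| →
      ‖c p q z π 0 - Complex.cos (π * t)‖ ≤ B / |(n : ℝ)| ∧
      ‖s p q z π 0 + σ * Complex.sin (π * t)‖ ≤ B / |(n : ℝ)| := by
  obtain ⟨K, Λ, hK, hΛ, hF⟩ := exists_monodromy_asymptotics hp hq 3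
  have hπ := Real.pi_pos
  set E := Real.exp (π * 3) with hE
  have hE0 : 0 < E := Real.exp_pos _
  refine ⟨K + E * (2 * (π * |C|)), by positivity, ?_⟩
  filter_upwards [eventually_largeInt_le 6, eventually_largeInt_le Λ,
    eventually_largeInt_div_le C (show (0 : ℝ) < 1 / 4 by norm_num)] with n hn6 hnΛ hn1 t ht z hz
  have hn0 : 0 < |(n : ℝ)| := by linarith
  have hπz : π * ‖z - (2 * n + σ * t)‖ ≤ 1 := by
    nlinarith [Real.pi_le_four, norm_nonneg (z - (2 * n + σ * t))]
  obtain ⟨him, hnorm⟩ := im_and_norm_bounds h_pos h_lt hσ hn6 ht (z := z) (by linarith)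
  obtain ⟨h1, h2, -⟩ := hF z him (hnΛ.trans hnorm)
  have hKz : K / ‖z‖ ≤ K / |(n : ℝ)| := by gcongr
  have hEz : E * (2 * (π * ‖z - (2 * n + σ * t)‖)) ≤ E * (2 * (π * |C|)) / |(n : ℝ)| := by
    have h3 : ‖z - (2 * n + σ * t)‖ ≤ |C| / |(n : ℝ)| :=
      hz.trans (by gcongr; exact le_abs_self C)
    calc _ ≤ E * (2 * (π * (|C| / |(n : ℝ)|))) := by gcongr
      _ = _ := by ring
  have h4 := norm_cos_pi_mul_sub_le h_pos h_lt hσ hn6 ht hπz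
  have h5 := norm_sin_pi_mul_sub_le h_pos h_lt hσ hn6 ht hπz
  rw [add_div]
  constructor
  · have h6 : c p q z π 0 - Complex.cos (π * t) = (c p q z π 0 - Complex.cos (π * z))
        + (Complex.cos (π * z) - Complex.cos (π * t)) := by ring
    rw [h6]
    refine (norm_add_le _ _).trans ?_
    linarith
  · have h6 : s p q z π 0 + σ * Complex.sin (π * t) = (s p q z π 0 + Complex.sin (π * z))
        - (Complex.sin (π * z) - σ * Complex.sin (π * t)) := by ring
    rw [h6]
    refine (norm_sub_le _ _).trans ?_
    linarith

theorem exists_s_ne_zero (hp : BoundedVariationOn p (Icc 0 π))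
    (hq : BoundedVariationOn q (Icc 0 π)) (h_pos : 0 < h) (h_lt : h < 1 / 10)
    (hσ : σ = 1 ∨ σ = -1) (C : ℝ) :
    ∃ κ : ℝ, 0 < κ ∧ ∀ᶠ n : ℤ in largeInt, ∀ t ∈ D h, ∀ z : ℂ,
      ‖z - (2 * n + σ * t)‖ ≤ C / |(n : ℝ)| → κ ≤ ‖s p q z π 0‖ := by
  obtain ⟨κ, hκ, hsin⟩ := exists_le_norm_sin_of_mem_D h_pos h_lt
  obtain ⟨B, -, hB⟩ := exists_monodromy_close hp hq h_pos h_lt hσ C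
  refine ⟨κ / 2, by positivity, ?_⟩
  filter_upwards [hB, eventually_largeInt_div_le B (half_pos hκ)] with n h1 h2 t ht z hz
  have h3 := (h1 t ht z hz).2
  have h4 : κ ≤ ‖σ * Complex.sin (π * t)‖ := by
    rw [norm_mul, norm_eq_one_of_sign hσ, one_mul]; exact hsin t ht
  have h5 := norm_sub_le (s p q z π 0 + σ * Complex.sin (π * t)) (s p q z π 0)
  rw [add_sub_cancel_left] at h5
  linarith

/-- The roots of `F(z) = 2 cos πt` are chosen separately for each `n` and `t`; no regularity in `t`
is required. -/
theorem exists_isEigenvalueSequence (hp : BoundedVariationOn p (Icc 0 π))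
    (hq : BoundedVariationOn q (Icc 0 π)) (h_pos : 0 < h) (h_lt : h < 1 / 10)
    (hσ : σ = 1 ∨ σ = -1) : ∃ lam : ℤ → ℂ → ℂ, IsEigenvalueSequence p q h σ lam := by
  obtain ⟨C, hC⟩ := exists_F_eq hp hq h_pos h_lt hσ
  obtain ⟨κ, hκ, hs⟩ := exists_s_ne_zero hp hq h_pos h_lt hσ C
  obtain ⟨N, hN⟩ := eventually_largeInt_iff.1 (hC.and hs)
  have H : ∀ n : ℤ, ∀ t : ℂ, ∃ z : ℂ, (N : ℤ) < |n| → t ∈ D h →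
      IsEigenvalue p q t z ∧ ‖z - (2 * n + σ * t)‖ ≤ C / |(n : ℝ)| := by
    intro n t
    by_cases hnt : (N : ℤ) < |n| ∧ t ∈ D h
    · obtain ⟨z, hz, hzn⟩ := (hN n hnt.1).1 t hnt.2
      refine ⟨z, fun _ _ => ⟨⟨_, isEigenfunction_Phi hp hq ?_ ?_⟩, hzn⟩⟩
      · exact norm_pos_iff.1 (hκ.trans_le ((hN n hnt.1).2 t hnt.2 z hzn))
      · have h1 : Complex.exp (Complex.I * π * t) * Complex.exp (-(Complex.I * π * t)) = 1 := by
          rw [← Complex.exp_add, add_neg_cancel, Complex.exp_zero]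
        rw [hz, Complex.cos_eq_cexp_I_mul, ← mul_assoc Complex.I]
        linear_combination -h1
    · exact ⟨0, fun h1 h2 => (hnt ⟨h1, h2⟩).elim⟩
  choose lam hlam using H
  exact ⟨lam, N, C, fun n hn t ht => hlam n t hn ht⟩

/-- The asymptotics of the eigenfunctions, for eigenvalues close to `2n + σt`. -/
theorem exists_eigenfunction_asymptotics (hp : BoundedVariationOn p (Icc 0 π))
    (hq : BoundedVariationOn q (Icc 0 π)) (h_pos : 0 < h) (h_lt : h < 1 / 10)
    (hσ : σ = 1 ∨ σ = -1) (C : ℝ) :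
    ∃ C' : ℝ, ∀ᶠ n : ℤ in largeInt, ∀ t ∈ D h, ∀ z : ℂ,
      ‖z - (2 * n + σ * t)‖ ≤ C / |(n : ℝ)| → ∀ x ∈ Icc 0 π,
        ‖(s p q z π 0)⁻¹ • Phi p q t z x
          - Complex.exp (Complex.I * (σ * (2 * n) + t) * x) • ![1, -(σ * Complex.I)]‖
          ≤ C' / |(n : ℝ)| := by
  obtain ⟨K, Λ, hK, hΛ, hfree⟩ := exists_solution_close_to_free hp hq 3
  obtain ⟨κ, hκ, hs⟩ := exists_s_ne_zero hp hq h_pos h_lt hσ C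
  obtain ⟨B, hB0, hB⟩ := exists_monodromy_close hp hq h_pos h_lt hσ C
  have hπ := Real.pi_pos
  set E := Real.exp (π * 3) with hE
  have hE0 : 0 < E := Real.exp_pos _
  have hσn := norm_eq_one_of_sign hσ
  have hσσ := mul_self_of_sign hσ
  refine ⟨K * 2 + 2 * B / κ * E + E * (2 * (π * |C|)), ?_⟩
  filter_upwards [eventually_largeInt_le 6, eventually_largeInt_le Λ, hs, hB,
    eventually_largeInt_div_le C (show (0 : ℝ) < 1 / 4 by norm_num),
    eventually_largeInt_div_le (2 * B / κ) one_pos]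
    with n hn6 hnΛ hsn hBn hn1 hn2 t ht z hz x hx
  have hn0 : 0 < |(n : ℝ)| := by linarith
  have hπz : π * ‖z - (2 * n + σ * t)‖ ≤ 1 := by
    nlinarith [Real.pi_le_four, norm_nonneg (z - (2 * n + σ * t))]
  obtain ⟨him, hnorm⟩ := im_and_norm_bounds h_pos h_lt hσ hn6 ht (z := z) (by linarith)
  have hs1 := hsn t ht z hz
  have hs0 : s p q z π 0 ≠ 0 := norm_pos_iff.1 (hκ.trans_le hs1)
  obtain ⟨hBc, hBs⟩ := hBn t ht z hz
  -- The second initial component of the normalized eigenfunction. Its limit is `i sin(πt) / (-σ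
  -- sin(πt)) = -σi`, since `σ² = 1`.
  set m : ℂ := (s p q z π 0)⁻¹ * (Complex.exp (Complex.I * π * t) - c p q z π 0) with hm
  have hmσ : ‖m + σ * Complex.I‖ ≤ 2 * B / κ / |(n : ℝ)| := by
    have h1 : Complex.exp (Complex.I * π * t)
        = Complex.cos (π * t) + Complex.I * Complex.sin (π * t) := by
      rw [mul_comm Complex.I (Complex.sin _), ← Complex.exp_mul_I]
      congr 1; ring
    have h2 : m + σ * Complex.I = (s p q z π 0)⁻¹ * (σ * Complex.I
        * (s p q z π 0 + σ * Complex.sin (π * t)) - (c p q z π 0 - Complex.cos (π * t))) := by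
      rw [hm, h1]
      field_simp
      linear_combination -(Complex.I * Complex.sin (π * t)) * hσσ
    rw [h2, norm_mul, norm_inv, inv_mul_le_iff₀ (hκ.trans_le hs1)]
    have h3 : κ * (2 * B / κ / |(n : ℝ)|) = B / |(n : ℝ)| + B / |(n : ℝ)| := by
      field_simp; ring
    refine le_trans ?_ (mul_le_mul_of_nonneg_right hs1 (by positivity))
    rw [h3]
    refine (norm_sub_le _ _).trans (add_le_add ?_ hBc)
    rw [norm_mul, norm_mul, hσn, Complex.norm_I, one_mul, one_mul]
    exact hBs
  have hm2 : ‖m‖ ≤ 2 := by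
    have h1 := norm_sub_le (m + σ * Complex.I) (σ * Complex.I)
    rw [add_sub_cancel_right, norm_mul σ, hσn, Complex.norm_I, one_mul] at h1
    linarith
  obtain ⟨hc, hc0⟩ := isSolution_solution hp hq z ![1, 0]
  obtain ⟨hs', hs0'⟩ := isSolution_solution hp hq z ![0, 1]
  set Ψ : ℝ → Fin 2 → ℂ := fun x => c p q z x + m • s p q z x with hΨ
  have hΨsol : IsSolution p q z Ψ := hc.add (hs'.const_smul m)
  have hΨ0 : Ψ 0 = ![1, m] := by
    have h1 : c p q z 0 = ![1, 0] := hc0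
    have h2 : s p q z 0 = ![0, 1] := hs0'
    simp only [hΨ, h1, h2]
    ext i; fin_cases i <;> simp
  have hΨn : ‖Ψ 0‖ ≤ 2 := by
    rw [hΨ0, pi_norm_le_iff_of_nonneg zero_le_two]
    intro i; fin_cases i
    · simp
    · simpa using hm2
  have hΦΨ : (s p q z π 0)⁻¹ • Phi p q t z x = Ψ x := by
    rw [Phi, smul_add, smul_smul, smul_smul, inv_mul_cancel₀ hs0, one_smul]
  have hKn : K / ‖z‖ * ‖Ψ 0‖ ≤ K * 2 / |(n : ℝ)| := by
    rw [mul_div_right_comm]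
    gcongr
  obtain ⟨hf0, hf1⟩ := hfree z him (hnΛ.trans hnorm) Ψ hΨsol x hx
  replace hf0 := hf0.trans hKn
  replace hf1 := hf1.trans hKn
  rw [hΨ0] at hf0 hf1
  simp only [Matrix.cons_val_zero, Matrix.cons_val_one, mul_one] at hf0 hf1
  have himx : ∀ u : ℂ, |u.im| ≤ 3 → Real.exp |(u * x).im| ≤ E := fun u hu => by
    rw [Complex.im_mul_ofReal, abs_mul, abs_of_nonneg hx.1, mul_comm]
    exact Real.exp_le_exp.2 (mul_le_mul hx.2 hu (abs_nonneg _) hπ.le)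
  set e := Complex.exp (Complex.I * (σ * (2 * n) + t) * x) with he
  -- `e' = exp(iσzx)` is the first component of the free solution with initial value `(1, -σi)`; `e`
  -- is the same exponential with `z` replaced by `2n + σt`.
  set e' := Complex.cos (z * x) + σ * Complex.I * Complex.sin (z * x) with he'
  have hee : ‖e' - e‖ ≤ E * (2 * (π * |C|)) / |(n : ℝ)| := by
    have hw : ‖(z - (2 * n + σ * t)) * x‖ ≤ π * ‖z - (2 * n + σ * t)‖ := by
      rw [norm_mul, Complex.norm_real, Real.norm_of_nonneg hx.1, mul_comm]
      exact mul_le_mul_of_nonneg_right hx.2 (norm_nonneg _)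
    have h0 := himx _ (im_and_norm_bounds h_pos h_lt hσ hn6 ht (z := 2 * n + σ * t) (by simp)).1
    have hexp : ‖e' - e‖ ≤ Real.exp |((2 * n + σ * t) * (x : ℂ)).im|
        * (2 * ‖(z - (2 * n + σ * t)) * x‖) := by
      rw [he', he, Complex.cos_eq_cexp_I_mul, Complex.sin_eq_cexp_I_mul]
      rcases hσ with rfl | rfl
      · have h1 := Complex.norm_cexp_I_mul_add_sub_le ((2 * n + 1 * t) * (x : ℂ)) (hw.trans hπz)
        refine le_trans (le_of_eq ?_) h1
        congr 1
        have h2 : (2 * n + 1 * t) * (x : ℂ) + (z - (2 * n + 1 * t)) * x = z * x := by ring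
        have h3 : Complex.I * (1 * (2 * n) + t) * x = Complex.I * ((2 * n + 1 * t) * x) := by ring
        rw [h2, h3]
        linear_combination (Complex.exp (-(Complex.I * (z * x))) - Complex.exp (Complex.I * (z * x)))
          / 2 * Complex.I_mul_I
      · have h1 := Complex.norm_cexp_neg_I_mul_add_sub_le ((2 * n + -1 * t) * (x : ℂ))
          (hw.trans hπz)
        refine le_trans (le_of_eq ?_) h1
        congr 1
        have h2 : (2 * n + -1 * t) * (x : ℂ) + (z - (2 * n + -1 * t)) * x = z * x := by ring
        have h3 : Complex.I * (-1 * (2 * n) + t) * x = -(Complex.I * ((2 * n + -1 * t) * x)) := by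
          ring
        rw [h2, h3]
        linear_combination (Complex.exp (Complex.I * (z * x)) - Complex.exp (-(Complex.I * (z * x))))
          / 2 * Complex.I_mul_I
    have h3 : ‖z - (2 * n + σ * t)‖ ≤ |C| / |(n : ℝ)| :=
      hz.trans (by gcongr; exact le_abs_self C)
    calc ‖e' - e‖ ≤ E * (2 * (π * ‖z - (2 * n + σ * t)‖)) :=
          hexp.trans (mul_le_mul h0 (by linarith) (by positivity) hE0.le)
      _ ≤ E * (2 * (π * (|C| / |(n : ℝ)|))) := by gcongr
      _ = _ := by ring
  have hmE : ∀ u : ℂ, ‖u‖ ≤ Real.exp |(z * x).im| →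
      ‖(m + σ * Complex.I) * u‖ ≤ 2 * B / κ * E / |(n : ℝ)| := fun u hu => by
    rw [norm_mul, mul_div_right_comm]
    exact mul_le_mul hmσ (hu.trans (himx z him)) (norm_nonneg _) (by positivity)
  rw [hΦΨ, add_div, add_div, pi_norm_le_iff_of_nonneg (by positivity), Fin.forall_fin_two]
  simp only [Pi.sub_apply, Pi.smul_apply, Matrix.cons_val_zero, Matrix.cons_val_one, smul_eq_mul,
    mul_one]
  constructor
  -- Three errors, matching the summands of the constant: deviation from the free solution, from `m`
  -- to its limit, and from `z` to `2n + σt`.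
  · have h1 : Ψ x 0 - e = (Ψ x 0 - (Complex.cos (z * x) - Complex.sin (z * x) * m))
        - (m + σ * Complex.I) * Complex.sin (z * x) + (e' - e) := by
      rw [he']; ring
    rw [h1]
    refine (norm_add_le _ _).trans (add_le_add ((norm_sub_le _ _).trans (add_le_add hf0 ?_)) hee)
    exact hmE _ (Complex.norm_sin_le_exp _)
  · have h1 : Ψ x 1 - e * -(σ * Complex.I)
        = (Ψ x 1 - (Complex.sin (z * x) + Complex.cos (z * x) * m))
        + (m + σ * Complex.I) * Complex.cos (z * x) + -(σ * Complex.I) * (e' - e) := by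
      rw [he']
      linear_combination (Complex.sin (z * x)) * (Complex.I_mul_I + Complex.I ^ 2 * hσσ)
    rw [h1]
    refine (norm_add_le _ _).trans (add_le_add ((norm_add_le _ _).trans (add_le_add hf1 ?_)) ?_)
    · exact hmE _ (Complex.norm_cos_le_exp _)
    · rw [norm_mul, norm_neg, norm_mul, hσn, Complex.norm_I, one_mul, one_mul]
      exact hee

/-- All the properties of an eigenvalue sequence close to `2n + σt` and of its eigenfunctions. -/
theorem IsEigenvalueSequence.eventually (hp : BoundedVariationOn p (Icc 0 π))
    (hq : BoundedVariationOn q (Icc 0 π)) (h_pos : 0 < h) (h_lt : h < 1 / 10)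
    (hσ : σ = 1 ∨ σ = -1) {lam : ℤ → ℂ → ℂ} (hlam : IsEigenvalueSequence p q h σ lam) :
    ∃ C : ℝ, ∀ᶠ n : ℤ in largeInt, ∀ t ∈ D h,
      deriv (F p q) (lam n t) ≠ 0 ∧ s p q (lam n t) π 0 ≠ 0 ∧
        IsEigenfunction p q t (lam n t) (Phi p q t (lam n t)) ∧
        ∀ x ∈ Icc 0 π, ‖(s p q (lam n t) π 0)⁻¹ • Phi p q t (lam n t) x
          - Complex.exp (Complex.I * (σ * (2 * n) + t) * x) • ![1, -(σ * Complex.I)]‖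
          ≤ C / |(n : ℝ)| := by
  obtain ⟨N, C, hNC⟩ := hlam
  have hev := eventually_largeInt_iff.2 ⟨N, hNC⟩
  obtain ⟨r, hr, hderiv⟩ := exists_deriv_F_ne_zero hp hq h_pos h_lt hσ
  obtain ⟨κ, hκ, hs⟩ := exists_s_ne_zero hp hq h_pos h_lt hσ C
  obtain ⟨C', hC'⟩ := exists_eigenfunction_asymptotics hp hq h_pos h_lt hσ C
  refine ⟨C', ?_⟩
  filter_upwards [hev, hderiv, hs, hC', eventually_largeInt_div_le C hr]
    with n h1 h2 h3 h4 h5 t ht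
  obtain ⟨heig, hclose⟩ := h1 t ht
  have hs0 : s p q (lam n t) π 0 ≠ 0 := norm_pos_iff.1 (hκ.trans_le (h3 t ht _ hclose))
  exact ⟨h2 t ht _ (hclose.trans h5), hs0,
    isEigenfunction_Phi hp hq hs0 (heig.characteristic_eq hp hq), h4 t ht _ hclose⟩

end Dirac
end

theorem theorem2 (p q : ℝ → ℂ)
    (hp : BoundedVariationOn p (Set.Icc 0 Real.pi)) (hq : BoundedVariationOn q (Set.Icc 0 Real.pi))
    (h : ℝ) (h_pos : 0 < h) (h_lt : h < 1 / 10) :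
    (∃ lam₁ lam₂ : ℤ → ℂ → ℂ, Dirac.IsEigenvalueSequence p q h 1 lam₁ ∧
      Dirac.IsEigenvalueSequence p q h (-1) lam₂) ∧
    ∀ lam₁ lam₂ : ℤ → ℂ → ℂ, Dirac.IsEigenvalueSequence p q h 1 lam₁ →
      Dirac.IsEigenvalueSequence p q h (-1) lam₂ →
      ∃ N : ℕ, ∃ C : ℝ, ∀ n : ℤ, (N : ℤ) < |n| → ∀ t ∈ Dirac.D h,
        (deriv (Dirac.F p q) (lam₁ n t) ≠ 0 ∧ Dirac.s p q (lam₁ n t) Real.pi 0 ≠ 0 ∧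
          Dirac.IsEigenfunction p q t (lam₁ n t) (Dirac.Phi p q t (lam₁ n t)) ∧
          ∀ x ∈ Set.Icc 0 Real.pi,
            ‖(Dirac.s p q (lam₁ n t) Real.pi 0)⁻¹ • Dirac.Phi p q t (lam₁ n t) x
              - Complex.exp (Complex.I * (2 * n + t) * x) • ![1, -Complex.I]‖ ≤ C / |(n : ℝ)|) ∧
        (deriv (Dirac.F p q) (lam₂ n t) ≠ 0 ∧ Dirac.s p q (lam₂ n t) Real.pi 0 ≠ 0 ∧
          Dirac.IsEigenfunction p q t (lam₂ n t) (Dirac.Phi p q t (lam₂ n t)) ∧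
          ∀ x ∈ Set.Icc 0 Real.pi,
            ‖(Dirac.s p q (lam₂ n t) Real.pi 0)⁻¹ • Dirac.Phi p q t (lam₂ n t) x
              - Complex.exp (Complex.I * (-2 * n + t) * x) • ![1, Complex.I]‖ ≤ C / |(n : ℝ)|) := by
  constructor
  · obtain ⟨lam₁, h₁⟩ := Dirac.exists_isEigenvalueSequence hp hq h_pos h_lt (Or.inl rfl)
    obtain ⟨lam₂, h₂⟩ := Dirac.exists_isEigenvalueSequence hp hq h_pos h_lt (Or.inr rfl)
    exact ⟨lam₁, lam₂, h₁, h₂⟩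
  · intro lam₁ lam₂ h₁ h₂
    obtain ⟨C₁, H₁⟩ := h₁.eventually hp hq h_pos h_lt (Or.inl rfl)
    obtain ⟨C₂, H₂⟩ := h₂.eventually hp hq h_pos h_lt (Or.inr rfl)
    obtain ⟨N, hN⟩ := eventually_largeInt_iff.1 (H₁.and H₂)
    refine ⟨N, max C₁ C₂, fun n hn t ht => ?_⟩
    obtain ⟨hd₁, hs₁, he₁, ha₁⟩ := (hN n hn).1 t ht
    obtain ⟨hd₂, hs₂, he₂, ha₂⟩ := (hN n hn).2 t ht
    refine ⟨⟨hd₁, hs₁, he₁, fun x hx => ?_⟩, ⟨hd₂, hs₂, he₂, fun x hx => ?_⟩⟩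
    · have h3 := ha₁ x hx
      rw [one_mul, one_mul] at h3
      exact h3.trans (by gcongr; exact le_max_left _ _)
    · have h3 := ha₂ x hx
      rw [neg_one_mul, neg_one_mul, neg_neg, ← neg_mul] at h3
      exact h3.trans (by gcongr; exact le_max_right _ _)
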